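/- Let $X$ be a compact complex manifold of dimension $3$ with a Kähler form $\chi$ (a closed positive real $(1,1)$-form), and let $\omega$ be a closed real $(1,1)$-form on $X$ (all forms smooth). For a smooth function $\varphi : X \to \mathbb{R}$ put $\omega_\varphi = \omega + \sqrt{-1}\,\partial\bar\partial\varphi$ and $$Q_\chi(\omega_\varphi) = \sum_{i=1}^{3} \operatorname{arccot}(\lambda_i),$$ where $\lambda_1,\lambda_2,\lambda_3$ are the eigenvalues of $\omega_\varphi$ with respect to $\chi$ at each point and $\operatorname{arccot}(x) = \frac{\pi}{2} - \arctan(x) \in (0,\pi)$. Suppose that for some constant $\theta \in (0,3\pi)$ the equation $Q_\chi(\omega_\varphi) = \theta$ on $X$ has a smooth solution $\varphi$. Then for every $t \in [0,1]$, $$\gamma([\omega],t) := \int_X (t\omega + \sqrt{-1}\,\chi)^3 \neq 0.$$ -/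

import Mathlib

open Set MeasureTheory
open scoped Manifold ContDiff Topology

noncomputable section

namespace DHYM

/-- The model space `ℂⁿ`, also regarded as a real vector space. -/
abbrev Cn (n : ℕ) : Type := Fin n → ℂ

/-- Multiplication by `√-1` on `ℂⁿ`, as a real-linear map. -/
def J (n : ℕ) : Cn n →L[ℝ] Cn n := Complex.I • ContinuousLinearMap.id ℝ (Cn n)

/-- The standard oriented real basis `e₁, √-1 e₁, …, eₙ, √-1 eₙ` of `ℂⁿ`: the index `(j, 0)`
stands for `eⱼ` and `(j, 1)` for `√-1 eⱼ`. -/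
def realBasis (n : ℕ) (p : Fin n × Fin 2) : Cn n :=
  Pi.single p.1 (if p.2 = 0 then 1 else Complex.I)

/-! ### Multilinear algebra -/

section Wedge

variable {V : Type*} [AddCommGroup V] [Module ℝ V] [TopologicalSpace V]

/-- The multilinear map `v ↦ ∏ⱼ α (v (j, 0), v (j, 1))` attached to a 2-form `α`. -/
def blockProduct (n : ℕ) (α : V [⋀^Fin 2]→L[ℝ] ℂ) :
    MultilinearMap ℝ (fun _ : Fin n × Fin 2 => V) ℂ where
  toFun v := ∏ j : Fin n, α (fun b => v (j, b))
  map_update_add' := by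
    rintro inst v ⟨i, b⟩ x y
    obtain rfl : inst = instDecidableEqProd := Subsingleton.elim _ _
    have key : ∀ z : V, (∏ j : Fin n, α (fun c => Function.update v (i, b) z (j, c)))
        = α (Function.update (fun c => v (i, c)) b z)
          * ∏ j ∈ Finset.univ.erase i, α (fun c => v (j, c)) := by
      intro z
      rw [← Finset.mul_prod_erase _ _ (Finset.mem_univ i)]
      congr 1
      · congr 1
        funext c
        by_cases h : c = b <;> simp [h]
      · refine Finset.prod_congr rfl fun j hj => ?_
        have hj' := (Finset.mem_erase.mp hj).1
        congr 1
        funext c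
        simp [hj']
    rw [key, key, key, α.map_update_add, add_mul]
  map_update_smul' := by
    rintro inst v ⟨i, b⟩ r x
    obtain rfl : inst = instDecidableEqProd := Subsingleton.elim _ _
    have key : ∀ z : V, (∏ j : Fin n, α (fun c => Function.update v (i, b) z (j, c)))
        = α (Function.update (fun c => v (i, c)) b z)
          * ∏ j ∈ Finset.univ.erase i, α (fun c => v (j, c)) := by
      intro z
      rw [← Finset.mul_prod_erase _ _ (Finset.mem_univ i)]
      congr 1
      · congr 1
        funext c
        by_cases h : c = b <;> simp [h]
      · refine Finset.prod_congr rfl fun j hj => ?_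
        have hj' := (Finset.mem_erase.mp hj).1
        congr 1
        funext c
        simp [hj']
    rw [key, key, α.map_update_smul, smul_mul_assoc]

/-- The exterior power `αⁿ = α ∧ ⋯ ∧ α` of a complex-valued 2-form, a `2n`-form:
`αⁿ (v) = 2⁻ⁿ ∑_σ sgn σ ∏ⱼ α (v_σ(j,0), v_σ(j,1))`, the sum being over all permutations of the
`2n` arguments, which are indexed by `Fin n × Fin 2`. -/
def wedgePow (n : ℕ) (α : V [⋀^Fin 2]→L[ℝ] ℂ) : V [⋀^(Fin n × Fin 2)]→ₗ[ℝ] ℂ :=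
  ((2 : ℝ) ^ n)⁻¹ • MultilinearMap.alternatization (blockProduct n α)

end Wedge

/-- `arccot x = π / 2 - arctan x`, with values in `(0, π)`. -/
def arccot (x : ℝ) : ℝ := Real.pi / 2 - Real.arctan x

/-- The coefficient matrix `(a_{jk})` of a real `(1,1)`-form
`α = √-1 ∑ a_{jk} dzⱼ ∧ dz̄ₖ` on `ℂⁿ`, that is
`a_{jk} = (α (eⱼ, √-1 eₖ) - √-1 α (eⱼ, eₖ)) / 2`. -/
def coeffMatrix {n : ℕ} (α : Cn n [⋀^Fin 2]→L[ℝ] ℝ) : Matrix (Fin n) (Fin n) ℂ :=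
  Matrix.of fun j k =>
    ((α ![Pi.single j 1, Pi.single k Complex.I] : ℂ)
      - Complex.I * (α ![Pi.single j 1, Pi.single k 1] : ℂ)) / 2

/-- The eigenvalues, with multiplicity, of a real `(1,1)`-form `α` with respect to a positive
real `(1,1)`-form `χ` on `ℂⁿ`: the roots of the characteristic polynomial of `χ⁻¹ α`. These roots
are real, so taking real parts only changes their type. -/
def relEigenvalues {n : ℕ} (χ α : Cn n [⋀^Fin 2]→L[ℝ] ℝ) : Multiset ℝ :=
  ((coeffMatrix χ)⁻¹ * coeffMatrix α).charpoly.roots.map Complex.re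

/-! ### The operator `√-1 ∂∂̄` on `ℂⁿ` -/

/-- The 1-form `dᶜf = √-1 (∂̄ - ∂) f`, that is `(dᶜf)(v) = - df (√-1 v)`, of a real function. -/
def dc {n : ℕ} (f : Cn n → ℝ) (y : Cn n) : Cn n [⋀^Fin 1]→L[ℝ] ℝ :=
  ContinuousAlternatingMap.ofSubsingleton ℝ (Cn n) ℝ (0 : Fin 1) (-(fderiv ℝ f y ∘L J n))

/-- The real 2-form `√-1 ∂∂̄ f = (1/2) d dᶜ f` of a real function on `ℂⁿ`. -/
def ddbarLocal {n : ℕ} (f : Cn n → ℝ) (y : Cn n) : Cn n [⋀^Fin 2]→L[ℝ] ℝ :=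
  (1 / 2 : ℝ) • extDeriv (dc f) y

/-! ### Differential forms on a complex manifold

A complex manifold of dimension `n` is a space `X` with an atlas of charts with values in `ℂⁿ` and
holomorphic transition maps. The same charts make it a real manifold. -/

section Manifold

variable {n : ℕ} {X : Type*} [TopologicalSpace X] [ChartedSpace (Cn n) X]

/-- A complex manifold is a smooth real manifold with the same charts. -/
theorem isManifold_real [IsManifold 𝓘(ℂ, Cn n) ω X] : IsManifold 𝓘(ℝ, Cn n) ∞ X := by
  refine isManifold_of_contDiffOn _ _ _ fun e e' he he' => ?_
  have h := (contDiffGroupoid ω 𝓘(ℂ, Cn n)).compatible he he'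
  rw [contDiffGroupoid, mem_groupoid_of_pregroupoid] at h
  exact (h.1.restrict_scalars ℝ).of_le le_top

variable (n X) in
/-- A field of alternating 2-forms with values in `F` on the real tangent spaces of `X`. -/
abbrev TwoForm (F : Type*) [NormedAddCommGroup F] [NormedSpace ℝ F] : Type _ :=
  (x : X) → TangentSpace 𝓘(ℝ, Cn n) x [⋀^Fin 2]→L[ℝ] F

/-- The local expression on `ℂⁿ` of a 2-form in a chart `e`: its pullback under `e⁻¹`
(meaningful on `e.target`). -/
def localRep {F : Type*} [NormedAddCommGroup F] [NormedSpace ℝ F] (α : TwoForm n X F)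
    (e : OpenPartialHomeomorph X (Cn n)) (y : Cn n) : Cn n [⋀^Fin 2]→L[ℝ] F :=
  (α (e.symm y)).compContinuousLinearMap (mfderiv 𝓘(ℝ, Cn n) 𝓘(ℝ, Cn n) e.symm y)

/-- A closed real `(1,1)`-form: in every chart of the atlas it is smooth, invariant under `√-1`,
and its exterior derivative vanishes. -/
structure IsClosedRealOneOne (α : TwoForm n X ℝ) : Prop where
  smooth : ∀ e ∈ atlas (Cn n) X, ContDiffOn ℝ ∞ (localRep α e) e.target
  oneOne : ∀ e ∈ atlas (Cn n) X, ∀ y ∈ e.target, ∀ v w : Cn n,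
    localRep α e y ![J n v, J n w] = localRep α e y ![v, w]
  closed : ∀ e ∈ atlas (Cn n) X, ∀ y ∈ e.target, extDeriv (localRep α e) y = 0

/-- A Kähler form: a closed real `(1,1)`-form which is positive. -/
structure IsKahlerForm (χ : TwoForm n X ℝ) : Prop extends IsClosedRealOneOne χ where
  positive : ∀ e ∈ atlas (Cn n) X, ∀ y ∈ e.target, ∀ v : Cn n, v ≠ 0 →
    0 < localRep χ e y ![v, J n v]

/-- The form `√-1 ∂∂̄ φ` on `X`, computed at `x` in the preferred chart at `x`. -/
def ddbar (φ : X → ℝ) : TwoForm n X ℝ := fun x =>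
  (ddbarLocal (φ ∘ (chartAt (Cn n) x).symm) (chartAt (Cn n) x x)).compContinuousLinearMap
    (mfderiv 𝓘(ℝ, Cn n) 𝓘(ℝ, Cn n) (chartAt (Cn n) x) x)

/-- `Q_χ(α) = ∑ᵢ arccot λᵢ`, where the `λᵢ` are the eigenvalues of `α` with respect to `χ`; at the
point `x` these are computed in the preferred chart at `x`. -/
def Q (χ α : TwoForm n X ℝ) (x : X) : ℝ :=
  ((relEigenvalues (localRep χ (chartAt (Cn n) x) (chartAt (Cn n) x x))
    (localRep α (chartAt (Cn n) x) (chartAt (Cn n) x x))).map arccot).sum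

/-- The complex-valued 2-form `t α + √-1 χ`. -/
def complexForm (χ α : TwoForm n X ℝ) (t : ℝ) : TwoForm n X ℂ := fun x =>
  t • Complex.ofRealCLM.compContinuousAlternatingMap (α x)
    + Complex.I • Complex.ofRealCLM.compContinuousAlternatingMap (χ x)

variable (n X) in
/-- A complex-valued form of top degree `2n` on `X`. -/
abbrev TopForm : Type _ := (x : X) → TangentSpace 𝓘(ℝ, Cn n) x [⋀^(Fin n × Fin 2)]→ₗ[ℝ] ℂ

/-- The coefficient of a top form in a chart `e`, with respect to
`dx₁ ∧ dy₁ ∧ ⋯ ∧ dxₙ ∧ dyₙ` (meaningful on `e.target`). -/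
def topCoeff (Ω : TopForm n X) (e : OpenPartialHomeomorph X (Cn n)) (y : Cn n) : ℂ :=
  Ω (e.symm y) fun p => mfderiv 𝓘(ℝ, Cn n) 𝓘(ℝ, Cn n) e.symm y (realBasis n p)

variable (n X) in
/-- A smooth partition of unity subordinate to the domains of the preferred charts. -/
def chartPartition [IsManifold 𝓘(ℂ, Cn n) ω X] [T2Space X] [SigmaCompactSpace X] :
    SmoothPartitionOfUnity X 𝓘(ℝ, Cn n) X univ :=
  haveI : IsManifold 𝓘(ℝ, Cn n) ∞ X := isManifold_real
  (SmoothPartitionOfUnity.exists_isSubordinate_chartAt_source 𝓘(ℝ, Cn n) X).choose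

theorem chartPartition_isSubordinate [IsManifold 𝓘(ℂ, Cn n) ω X] [T2Space X]
    [SigmaCompactSpace X] :
    (chartPartition n X).IsSubordinate fun x => (chartAt (Cn n) x).source :=
  haveI : IsManifold 𝓘(ℝ, Cn n) ∞ X := isManifold_real
  (SmoothPartitionOfUnity.exists_isSubordinate_chartAt_source 𝓘(ℝ, Cn n) X).choose_spec

/-- The integral `∫_X Ω` of a top form over a compact complex manifold with its complex
orientation: `∑ᵢ ∫ ρᵢ Ω` for a smooth partition of unity `(ρᵢ)` subordinate to charts, each summand
being a Lebesgue integral over the image of the chart in `ℂⁿ = ℝ²ⁿ`. On a compact `X` only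
finitely many `ρᵢ` are not identically zero. -/
def integral [IsManifold 𝓘(ℂ, Cn n) ω X] [T2Space X] [CompactSpace X] (Ω : TopForm n X) : ℂ :=
  ∑ᶠ i : X, ∫ y in (chartAt (Cn n) i).target,
    (chartPartition n X i ((chartAt (Cn n) i).symm y) : ℂ) * topCoeff Ω (chartAt (Cn n) i) y

/-- `γ([α], t) = ∫_X (t α + √-1 χ)ⁿ`. -/
def gamma [IsManifold 𝓘(ℂ, Cn n) ω X] [T2Space X] [CompactSpace X] (χ α : TwoForm n X ℝ)
    (t : ℝ) : ℂ :=
  integral fun x => wedgePow n (complexForm χ α t x)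

end Manifold

end DHYM

end

noncomputable section

namespace DHYM

/-! ### The phase of `∏ (t λᵢ + √-1)` -/

/-! At each point, simultaneous diagonalisation of χ and ω_φ shows that the coefficient of (t ω_φ +
√-1 χ)³ against the complex orientation is a positive multiple of z = ∏ (t λᵢ + √-1)
(`exists_wedgePow_eq`). It therefore suffices to find one ζ, depending only on θ and t, with Re (ζ
z) > 0 for all triples with ∑ arccot λᵢ = θ (`exists_halfPlane`). Then Re (ζ γ) > 0, because it is
the integral of a positive density (`gamma_ne_zero`).

The half-plane comes from the elementary symmetric functions e₁, e₂, e₃ of the λᵢ. The equation says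
e₃ - e₁ = R cos θ and e₂ - 1 = R sin θ with R > 0, while Re z = t³ e₃ - t e₁ and Im z = t² e₂ - 1.
At t = 1 the number z lies on the ray of direction θ. If sin θ ≤ 0 then e₂ ≤ 1, so Im z < 0 for t <
1; at t = 0, z = -√-1. In the remaining case θ < π or θ > 2π, and eliminating R gives -sin θ Re z +
t cos θ Im z = t (1 - t²) (e₁ sin θ - cos θ), whose last factor has a constant sign
(`cos_lt_sum_mul_sin`, `sum_mul_sin_lt_cos`).

Passing from ω to ω_φ does not change γ (`gamma_add_ddbar`). A partition of unity reduces this to a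
potential supported in one chart. There the difference of the cubes is a multiple of √-1 ∂∂̄ψ wedged
with closed forms, and Stokes' theorem for compactly supported functions on ℂ³ applies
(`setIntegral_tri_ddbarLocal`). -/

theorem arccot_pos (x : ℝ) : 0 < arccot x := by
  have := Real.arctan_lt_pi_div_two x
  unfold arccot; linarith

theorem arccot_lt_pi (x : ℝ) : arccot x < Real.pi := by
  have := Real.neg_pi_div_two_lt_arctan x
  unfold arccot; linarith

theorem arccot_neg (x : ℝ) : arccot (-x) = Real.pi - arccot x := by
  unfold arccot; rw [Real.arctan_neg]; ring

theorem cos_arccot (x : ℝ) : Real.cos (arccot x) = x * Real.sin (arccot x) := by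
  unfold arccot
  rw [Real.cos_pi_div_two_sub, Real.sin_pi_div_two_sub, Real.sin_arctan, Real.cos_arctan]
  ring

theorem sin_arccot_pos (x : ℝ) : 0 < Real.sin (arccot x) :=
  Real.sin_pos_of_pos_of_lt_pi (arccot_pos x) (arccot_lt_pi x)

/-- If the three angles add up to `θ`, then `∏ (λᵢ + √-1)` is a positive multiple of `e^{√-1 θ}`. -/
theorem exists_pos_symm_eq (a b c θ : ℝ) (h : arccot a + arccot b + arccot c = θ) :
    ∃ R : ℝ, 0 < R ∧ a * b * c - (a + b + c) = R * Real.cos θ ∧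
      a * b + b * c + c * a - 1 = R * Real.sin θ := by
  have ha := sin_arccot_pos a
  have hb := sin_arccot_pos b
  have hc := sin_arccot_pos c
  -- R is forced by λ + √-1 = e^{√-1 arccot λ} / sin (arccot λ).
  refine ⟨(Real.sin (arccot a) * Real.sin (arccot b) * Real.sin (arccot c))⁻¹, by positivity, ?_, ?_⟩
  · rw [← h, Real.cos_add, Real.cos_add, Real.sin_add, cos_arccot, cos_arccot, cos_arccot]
    field_simp
    ring
  · rw [← h, Real.sin_add, Real.cos_add, Real.sin_add, cos_arccot, cos_arccot, cos_arccot]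
    field_simp
    ring

/-- Split e₁ sin θ - cos θ as (b + c) sin θ + (a sin θ - cos θ). The first term is positive because
arccot b + arccot c lies in (0, π), the second because θ - arccot a does. -/
theorem cos_lt_sum_mul_sin (a b c θ : ℝ) (h : arccot a + arccot b + arccot c = θ)
    (hθ : θ < Real.pi) : Real.cos θ < (a + b + c) * Real.sin θ := by
  have ha := sin_arccot_pos a
  have hb := sin_arccot_pos b
  have hc := sin_arccot_pos c
  have h1 := arccot_pos a
  have h2 := arccot_pos b
  have h3 := arccot_pos c
  have hs : 0 < Real.sin θ := Real.sin_pos_of_pos_of_lt_pi (by linarith) hθ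
  have hbc : 0 < b + c := by
    have h4 : 0 < Real.sin (arccot b + arccot c) :=
      Real.sin_pos_of_pos_of_lt_pi (by linarith) (by linarith)
    rw [Real.sin_add, cos_arccot, cos_arccot] at h4
    have h5 : 0 < (b + c) * (Real.sin (arccot b) * Real.sin (arccot c)) := by linarith
    exact pos_of_mul_pos_left h5 (by positivity)
  have haθ : 0 < a * Real.sin θ - Real.cos θ := by
    have h4 : 0 < Real.sin (θ - arccot a) :=
      Real.sin_pos_of_pos_of_lt_pi (by linarith) (by linarith)
    rw [Real.sin_sub, cos_arccot] at h4
    have h5 : 0 < (a * Real.sin θ - Real.cos θ) * Real.sin (arccot a) := by linarith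
    exact pos_of_mul_pos_left h5 ha.le
  nlinarith [mul_pos hbc hs]

/-- The reflection λ ↦ -λ turns θ into 3π - θ and reduces this to the case of an angle below π. -/
theorem sum_mul_sin_lt_cos (a b c θ : ℝ) (h : arccot a + arccot b + arccot c = θ)
    (hθ : 2 * Real.pi < θ) : (a + b + c) * Real.sin θ < Real.cos θ := by
  have key := cos_lt_sum_mul_sin (-a) (-b) (-c) (3 * Real.pi - θ)
    (by rw [arccot_neg, arccot_neg, arccot_neg]; linarith) (by linarith)
  have e : 3 * Real.pi - θ = (Real.pi - θ) + 2 * Real.pi := by ring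
  rw [e, Real.cos_add_two_pi, Real.sin_add_two_pi, Real.cos_pi_sub, Real.sin_pi_sub] at key
  linarith

theorem re_prod_eq (a b c t : ℝ) :
    (((t * a : ℂ) + Complex.I) * (t * b + Complex.I) * (t * c + Complex.I)).re
      = t ^ 3 * (a * b * c) - t * (a + b + c) := by
  simp [Complex.mul_re, Complex.mul_im]; ring

theorem im_prod_eq (a b c t : ℝ) :
    (((t * a : ℂ) + Complex.I) * (t * b + Complex.I) * (t * c + Complex.I)).im
      = t ^ 2 * (a * b + b * c + c * a) - 1 := by
  simp [Complex.mul_re, Complex.mul_im]; ring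

/-- For a fixed phase `θ` and `t ∈ [0, 1]`, the numbers `∏ (t λᵢ + √-1)` all lie in one open
half-plane. -/
theorem exists_halfPlane (θ t : ℝ) (ht : t ∈ Icc (0 : ℝ) 1) :
    ∃ ζ : ℂ, ∀ a b c : ℝ, arccot a + arccot b + arccot c = θ →
      0 < (ζ * (((t * a : ℂ) + Complex.I) * (t * b + Complex.I) * (t * c + Complex.I))).re := by
  obtain ⟨ht0, ht1⟩ := ht
  rcases ht1.eq_or_lt with rfl | ht1
  -- At t = 1 the product is R e^{√-1 θ}, so ζ = e^{-√-1 θ} rotates it to R.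
  · refine ⟨⟨Real.cos θ, -Real.sin θ⟩, fun a b c h => ?_⟩
    obtain ⟨R, hR, h1, h2⟩ := exists_pos_symm_eq a b c θ h
    rw [Complex.mul_re, re_prod_eq, im_prod_eq]
    have h3 : (1 : ℝ) ^ 3 * (a * b * c) - 1 * (a + b + c) = R * Real.cos θ := by linarith
    have h4 : (1 : ℝ) ^ 2 * (a * b + b * c + c * a) - 1 = R * Real.sin θ := by linarith
    rw [h3, h4]
    have := Real.sin_sq_add_cos_sq θ
    have e : Real.cos θ * (R * Real.cos θ) - -Real.sin θ * (R * Real.sin θ) = R := by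
      linear_combination R * this
    exact hR.trans_eq e.symm
  have ht2 : t ^ 2 < 1 := by nlinarith
  rcases le_or_gt (Real.sin θ) 0 with hs | hs
  -- Since Re (√-1 z) = -Im z, the claim is t² e₂ < 1; here e₂ ≤ 1 and t² < 1.
  · refine ⟨Complex.I, fun a b c h => ?_⟩
    obtain ⟨R, hR, h1, h2⟩ := exists_pos_symm_eq a b c θ h
    rw [Complex.I_mul_re, im_prod_eq]
    have h3 : a * b + b * c + c * a ≤ 1 := by nlinarith
    nlinarith [sq_nonneg t]
  rcases ht0.eq_or_lt with rfl | ht0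
  · refine ⟨Complex.I, fun a b c h => ?_⟩
    rw [Complex.I_mul_re, im_prod_eq]
    norm_num
  have hcase : θ < Real.pi ∨ 2 * Real.pi < θ := by
    by_contra hcon
    push Not at hcon
    have : 0 ≤ Real.sin (θ - Real.pi) :=
      Real.sin_nonneg_of_nonneg_of_le_pi (by linarith) (by linarith)
    rw [Real.sin_sub_pi] at this
    linarith
  -- This combination of real and imaginary parts is the one in which R cancels, leaving a multiple
  -- of e₁ sin θ - cos θ.
  have key : ∀ a b c : ℝ, arccot a + arccot b + arccot c = θ →
      -Real.sin θ * (t ^ 3 * (a * b * c) - t * (a + b + c))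
        + t * Real.cos θ * (t ^ 2 * (a * b + b * c + c * a) - 1)
        = t * (1 - t ^ 2) * ((a + b + c) * Real.sin θ - Real.cos θ) := by
    intro a b c h
    obtain ⟨R, hR, h1, h2⟩ := exists_pos_symm_eq a b c θ h
    linear_combination (-t ^ 3 * Real.sin θ) * h1 + t ^ 3 * Real.cos θ * h2
  have hpos : 0 < t * (1 - t ^ 2) := mul_pos ht0 (by linarith)
  rcases hcase with hθ' | hθ'
  · refine ⟨⟨-Real.sin θ, -(t * Real.cos θ)⟩, fun a b c h => ?_⟩
    rw [Complex.mul_re, re_prod_eq, im_prod_eq]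
    have h1 := key a b c h
    have h2 := mul_pos hpos (sub_pos.2 (cos_lt_sum_mul_sin a b c θ h hθ'))
    linarith
  · refine ⟨⟨Real.sin θ, t * Real.cos θ⟩, fun a b c h => ?_⟩
    rw [Complex.mul_re, re_prod_eq, im_prod_eq]
    have h1 := key a b c h
    have h2 := mul_pos hpos (sub_pos.2 (sum_mul_sin_lt_cos a b c θ h hθ'))
    linarith

/-! ### Alternating sums over the permutations of six arguments -/

/-- The alternating sum `∑_σ sgn σ a (σ₁, σ₂) b (σ₃, σ₄) c (σ₅, σ₆)`: up to a factor, the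
coefficient of the wedge product of three 2-forms with coefficients `a`, `b`, `c`. -/
def tri (a b c : Fin 3 × Fin 2 → Fin 3 × Fin 2 → ℂ) : ℂ :=
  ∑ σ : Equiv.Perm (Fin 3 × Fin 2), ((Equiv.Perm.sign σ : ℤ) : ℂ) *
    (a (σ (0, 0)) (σ (0, 1)) * b (σ (1, 0)) (σ (1, 1)) * c (σ (2, 0)) (σ (2, 1)))

theorem sum_perm_comp_right (κ : Equiv.Perm (Fin 3 × Fin 2))
    (F : Equiv.Perm (Fin 3 × Fin 2) → ℂ) : ∑ σ, F (σ * κ) = ∑ σ, F σ :=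
  Equiv.sum_comp (Equiv.mulRight κ) F

/-- Exchanging two pairs of arguments is a product of two transpositions, hence even: 2-forms
commute. -/
theorem tri_swap_left (a b c : Fin 3 × Fin 2 → Fin 3 × Fin 2 → ℂ) : tri a b c = tri b a c := by
  let κ : Equiv.Perm (Fin 3 × Fin 2) :=
    Equiv.swap (0, 0) (1, 0) * Equiv.swap (0, 1) (1, 1)
  have hs : Equiv.Perm.sign κ = 1 := by
    simp [κ, Equiv.Perm.sign_mul]
  rw [tri, ← sum_perm_comp_right κ]
  refine Finset.sum_congr rfl fun σ _ => ?_
  rw [Equiv.Perm.sign_mul, hs]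
  have h00 : κ (0, 0) = (1, 0) := by decide
  have h01 : κ (0, 1) = (1, 1) := by decide
  have h10 : κ (1, 0) = (0, 0) := by decide
  have h11 : κ (1, 1) = (0, 1) := by decide
  have h20 : κ (2, 0) = (2, 0) := by decide
  have h21 : κ (2, 1) = (2, 1) := by decide
  simp only [Equiv.Perm.mul_apply, h00, h01, h10, h11, h20, h21, mul_one]
  ring

theorem tri_swap_right (a b c : Fin 3 × Fin 2 → Fin 3 × Fin 2 → ℂ) : tri a b c = tri a c b := by
  let κ : Equiv.Perm (Fin 3 × Fin 2) :=
    Equiv.swap (1, 0) (2, 0) * Equiv.swap (1, 1) (2, 1)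
  have hs : Equiv.Perm.sign κ = 1 := by
    simp [κ, Equiv.Perm.sign_mul]
  rw [tri, ← sum_perm_comp_right κ]
  refine Finset.sum_congr rfl fun σ _ => ?_
  rw [Equiv.Perm.sign_mul, hs]
  have h00 : κ (0, 0) = (0, 0) := by decide
  have h01 : κ (0, 1) = (0, 1) := by decide
  have h10 : κ (1, 0) = (2, 0) := by decide
  have h11 : κ (1, 1) = (2, 1) := by decide
  have h20 : κ (2, 0) = (1, 0) := by decide
  have h21 : κ (2, 1) = (1, 1) := by decide
  simp only [Equiv.Perm.mul_apply, h00, h01, h10, h11, h20, h21, mul_one]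
  ring

theorem tri_add_left (a a' b c : Fin 3 × Fin 2 → Fin 3 × Fin 2 → ℂ) :
    tri (a + a') b c = tri a b c + tri a' b c := by
  simp only [tri, ← Finset.sum_add_distrib, Pi.add_apply]
  exact Finset.sum_congr rfl fun σ _ => by ring

theorem tri_smul_left (r : ℂ) (a b c : Fin 3 × Fin 2 → Fin 3 × Fin 2 → ℂ) :
    tri (r • a) b c = r * tri a b c := by
  simp only [tri, Finset.mul_sum, Pi.smul_apply, smul_eq_mul]
  exact Finset.sum_congr rfl fun σ _ => by ring

/-- The difference of two cubes, by telescoping. -/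
theorem tri_add_sub (N B : Fin 3 × Fin 2 → Fin 3 × Fin 2 → ℂ) :
    tri (B + N) (B + N) (B + N) - tri B B B
      = tri N (B + N) (B + N) + tri N B (B + N) + tri N B B := by
  have h1 : tri (B + N) (B + N) (B + N) = tri N (B + N) (B + N) + tri B (B + N) (B + N) := by
    rw [tri_add_left, add_comm]
  have h2 : tri B (B + N) (B + N) = tri N B (B + N) + tri B B (B + N) := by
    rw [tri_swap_left, tri_add_left, add_comm]
  have h3 : tri B B (B + N) = tri N B B + tri B B B := by
    rw [tri_swap_right, tri_swap_left, tri_add_left, add_comm]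
  rw [h1, h2, h3]; ring

/-- Antisymmetrising in the first pair of indices only doubles the sum. -/
theorem tri_antisymm (d b c : Fin 3 × Fin 2 → Fin 3 × Fin 2 → ℂ) :
    tri (fun p q => (d p q - d q p) / 2) b c = tri d b c := by
  let κ : Equiv.Perm (Fin 3 × Fin 2) := Equiv.swap (0, 0) (0, 1)
  have hs : Equiv.Perm.sign κ = -1 := by
    simp [κ]
  have hκ : tri (fun p q => d q p) b c = - tri d b c := by
    rw [tri, ← sum_perm_comp_right κ, tri, ← Finset.sum_neg_distrib]
    refine Finset.sum_congr rfl fun σ _ => ?_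
    rw [Equiv.Perm.sign_mul, hs]
    have h00 : κ (0, 0) = (0, 1) := by decide
    have h01 : κ (0, 1) = (0, 0) := by decide
    have h10 : κ (1, 0) = (1, 0) := by decide
    have h11 : κ (1, 1) = (1, 1) := by decide
    have h20 : κ (2, 0) = (2, 0) := by decide
    have h21 : κ (2, 1) = (2, 1) := by decide
    simp only [Equiv.Perm.mul_apply, h00, h01, h10, h11, h20, h21]
    push_cast
    ring
  have e : (fun p q => (d p q - d q p) / 2)
      = (1 / 2 : ℂ) • d + (-(1 / 2) : ℂ) • (fun p q => d q p) := by
    funext p q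
    simp only [Pi.add_apply, Pi.smul_apply, smul_eq_mul]
    ring
  rw [e, tri_add_left, tri_smul_left, tri_smul_left, hκ]
  ring

/-- A sum that vanishes after summation over a 3-cycle of the arguments `σ₁, σ₃, σ₄` vanishes. -/
theorem sum_perm_eq_zero_of_cyclic (u : Fin 3 × Fin 2 → ℂ) (c : Fin 3 × Fin 2 → Fin 3 × Fin 2 → ℂ)
    (D : Fin 3 × Fin 2 → Fin 3 × Fin 2 → Fin 3 × Fin 2 → ℂ)
    (hD : ∀ p q r, D p q r + D q r p + D r p q = 0) :
    ∑ σ : Equiv.Perm (Fin 3 × Fin 2), ((Equiv.Perm.sign σ : ℤ) : ℂ) *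
      (u (σ (0, 1)) * D (σ (0, 0)) (σ (1, 0)) (σ (1, 1)) * c (σ (2, 0)) (σ (2, 1))) = 0 := by
  let κ : Equiv.Perm (Fin 3 × Fin 2) := Equiv.swap (0, 0) (1, 0) * Equiv.swap (1, 0) (1, 1)
  have hs : Equiv.Perm.sign κ = 1 := by
    simp [κ, Equiv.Perm.sign_mul]
  have h00 : κ (0, 0) = (1, 0) := by decide
  have h01 : κ (0, 1) = (0, 1) := by decide
  have h10 : κ (1, 0) = (1, 1) := by decide
  have h11 : κ (1, 1) = (0, 0) := by decide
  have h20 : κ (2, 0) = (2, 0) := by decide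
  have h21 : κ (2, 1) = (2, 1) := by decide
  set F : Equiv.Perm (Fin 3 × Fin 2) → ℂ := fun σ => ((Equiv.Perm.sign σ : ℤ) : ℂ) *
      (u (σ (0, 1)) * D (σ (0, 0)) (σ (1, 0)) (σ (1, 1)) * c (σ (2, 0)) (σ (2, 1))) with hF
  -- Three times the sum equals the sum of F over σ, σκ, σκ². As κ is an even 3-cycle fixing the
  -- remaining arguments, each such triple contains the cyclic sum in `hD`.
  have e1 := sum_perm_comp_right κ F
  have e2 := sum_perm_comp_right κ (fun σ => F (σ * κ))
  have e3 : ∑ σ, (F σ + F (σ * κ) + F (σ * κ * κ)) = 0 := by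
    refine Finset.sum_eq_zero fun σ _ => ?_
    simp only [hF, Equiv.Perm.sign_mul, hs, Equiv.Perm.mul_apply, h00, h01, h10, h11, h20, h21,
      mul_one]
    linear_combination ((Equiv.Perm.sign σ : ℤ) : ℂ) * u (σ (0, 1)) * c (σ (2, 0)) (σ (2, 1))
      * hD (σ (0, 0)) (σ (1, 0)) (σ (1, 1))
  rw [Finset.sum_add_distrib, Finset.sum_add_distrib, e2, e1] at e3
  linear_combination e3 / 3

/-- The version for a derivative falling on the third factor; the even exchange of the last two
pairs reduces it to the previous one. -/
theorem sum_perm_eq_zero_of_cyclic' (u : Fin 3 × Fin 2 → ℂ)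
    (b : Fin 3 × Fin 2 → Fin 3 × Fin 2 → ℂ)
    (D : Fin 3 × Fin 2 → Fin 3 × Fin 2 → Fin 3 × Fin 2 → ℂ)
    (hD : ∀ p q r, D p q r + D q r p + D r p q = 0) :
    ∑ σ : Equiv.Perm (Fin 3 × Fin 2), ((Equiv.Perm.sign σ : ℤ) : ℂ) *
      (u (σ (0, 1)) * b (σ (1, 0)) (σ (1, 1)) * D (σ (0, 0)) (σ (2, 0)) (σ (2, 1))) = 0 := by
  let κ : Equiv.Perm (Fin 3 × Fin 2) :=
    Equiv.swap (1, 0) (2, 0) * Equiv.swap (1, 1) (2, 1)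
  have hs : Equiv.Perm.sign κ = 1 := by
    simp [κ, Equiv.Perm.sign_mul]
  have h00 : κ (0, 0) = (0, 0) := by decide
  have h01 : κ (0, 1) = (0, 1) := by decide
  have h10 : κ (1, 0) = (2, 0) := by decide
  have h11 : κ (1, 1) = (2, 1) := by decide
  have h20 : κ (2, 0) = (1, 0) := by decide
  have h21 : κ (2, 1) = (1, 1) := by decide
  rw [← sum_perm_comp_right κ, ← sum_perm_eq_zero_of_cyclic u b D hD]
  refine Finset.sum_congr rfl fun σ _ => ?_
  simp only [Equiv.Perm.sign_mul, hs, Equiv.Perm.mul_apply, h00, h01, h10, h11, h20, h21, mul_one]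
  ring

/-! ### The cube of a 2-form evaluated in a frame -/

theorem wedgePow_three_apply {V : Type*} [AddCommGroup V] [Module ℝ V] [TopologicalSpace V]
    (α : V [⋀^Fin 2]→L[ℝ] ℂ) (v : Fin 3 × Fin 2 → V) :
    wedgePow 3 α v = (1 / 8) * tri (fun p q => α ![v p, v q]) (fun p q => α ![v p, v q])
      (fun p q => α ![v p, v q]) := by
  have hα : ∀ (w : Fin 2 → V), α w = α ![w 0, w 1] := fun w => by
    congr 1; funext i; fin_cases i <;> rfl
  simp only [wedgePow, AlternatingMap.smul_apply, MultilinearMap.alternatization_apply, tri]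
  rw [← Complex.coe_smul, smul_eq_mul]
  congr 1
  · norm_num
  refine Finset.sum_congr rfl fun σ _ => ?_
  rw [Units.smul_def, zsmul_eq_mul]
  congr 1
  simp only [MultilinearMap.domDomCongr_apply, blockProduct, MultilinearMap.coe_mk]
  rw [Fin.prod_univ_three, hα, hα (fun b => v (σ (1, b))), hα (fun b => v (σ (2, b)))]

/-- A permutation preserving the three pairs is a permutation τ of the pairs, acting equally on both
members, times swaps inside pairs. The first factor has sign (sgn τ)² = 1, so only the reversed
pairs count. -/
theorem sign_blockPerm (σ : Equiv.Perm (Fin 3 × Fin 2))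
    (hσ : ∀ j, (σ (j, 0)).1 = (σ (j, 1)).1) :
    (∃ τ : Equiv.Perm (Fin 3), ∀ p, (σ p).1 = τ p.1) ∧
    (Equiv.Perm.sign σ : ℤ) = ∏ j, (if (σ (j, 0)).2 = 0 then 1 else -1) := by
  have hσ' : ∀ p : Fin 3 × Fin 2, (σ p).1 = (σ (p.1, 0)).1 := by
    rintro ⟨j, b⟩
    fin_cases b
    · rfl
    · exact (hσ j).symm
  have hsurj : Function.Surjective fun j => (σ (j, 0)).1 := fun k => by
    obtain ⟨p, hp⟩ := σ.surjective (k, 0)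
    exact ⟨p.1, (hσ' p).symm.trans (by rw [hp])⟩
  let τ : Equiv.Perm (Fin 3) := Equiv.ofBijective _ (Finite.injective_iff_bijective.1
    (Finite.injective_iff_surjective.2 hsurj))
  have hτ : ∀ p, (σ p).1 = τ p.1 := hσ'
  refine ⟨⟨τ, hτ⟩, ?_⟩
  let ε : Fin 3 → Equiv.Perm (Fin 2) := fun j =>
    if (σ (j, 0)).2 = 0 then 1 else Equiv.swap 0 1
  have hne : ∀ j, (σ (j, 0)).2 ≠ (σ (j, 1)).2 := fun j h => by
    have := σ.injective (Prod.ext (hσ j) h)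
    simp at this
  have hfac : σ = Equiv.prodCongrLeft (fun _ : Fin 2 => τ) * Equiv.prodCongrRight ε := by
    ext1 ⟨j, b⟩
    refine Prod.ext (hτ _) ?_
    have h2 := hne j
    simp only [Equiv.Perm.mul_apply, Equiv.prodCongrRight_apply, Equiv.prodCongrLeft_apply, ε]
    generalize h0 : (σ (j, 0)).2 = s at *
    generalize h1 : (σ (j, 1)).2 = s' at *
    fin_cases b
    · rw [show (σ (j, (⟨0, by decide⟩ : Fin 2))).2 = s from h0]
      revert h2; clear h0 h1; revert s s'; decide
    · rw [show (σ (j, (⟨1, by decide⟩ : Fin 2))).2 = s' from h1]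
      revert h2; clear h0 h1; revert s s'; decide
  conv_lhs => rw [hfac]
  rw [Equiv.Perm.sign_mul, Equiv.Perm.sign_prodCongrLeft, Equiv.Perm.sign_prodCongrRight,
    Fin.prod_univ_two, Int.units_mul_self, one_mul, Units.coe_prod]
  refine Finset.prod_congr rfl fun j _ => ?_
  simp only [ε]
  split_ifs <;> simp

/-- The value of the top power in a frame that diagonalises the 2-form. -/
theorem exists_pos_tri_diagonal : ∃ C : ℝ, 0 < C ∧ ∀ (μ : Fin 3 → ℂ)
    (M : Fin 3 × Fin 2 → Fin 3 × Fin 2 → ℂ), (∀ p q, p.1 ≠ q.1 → M p q = 0) →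
    (∀ j, M (j, 0) (j, 1) = μ j) → (∀ j, M (j, 1) (j, 0) = - μ j) →
    tri M M M = C * ∏ j, μ j := by
  classical
  -- C counts the permutations that preserve the pairs. All others contribute 0, and for these the
  -- sign of σ cancels the signs of the entries ±μ, so each contributes ∏ μⱼ.
  refine ⟨(Finset.univ.filter fun σ : Equiv.Perm (Fin 3 × Fin 2) =>
    ∀ j, (σ (j, 0)).1 = (σ (j, 1)).1).card, ?_, fun μ M h0 h1 h2 => ?_⟩
  · exact_mod_cast Finset.card_pos.2 ⟨1, by simp⟩
  have e : ∀ σ : Equiv.Perm (Fin 3 × Fin 2),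
      M (σ (0, 0)) (σ (0, 1)) * M (σ (1, 0)) (σ (1, 1)) * M (σ (2, 0)) (σ (2, 1))
        = ∏ j, M (σ (j, 0)) (σ (j, 1)) := fun σ => by rw [Fin.prod_univ_three]
  simp only [tri, e]
  rw [← Finset.sum_filter_of_ne (p := fun σ : Equiv.Perm (Fin 3 × Fin 2) =>
    ∀ j, (σ (j, 0)).1 = (σ (j, 1)).1), Finset.sum_congr rfl (g := fun _ => ∏ j, μ j)]
  · rw [Finset.sum_const, nsmul_eq_mul]; simp
  · intro σ hσ
    have hσ := (Finset.mem_filter.1 hσ).2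
    obtain ⟨⟨τ, hτ⟩, hs⟩ := sign_blockPerm σ hσ
    rw [hs]
    push_cast
    rw [← Finset.prod_mul_distrib, ← Equiv.prod_comp τ μ]
    refine Finset.prod_congr rfl fun j _ => ?_
    have a0 := hτ (j, 0)
    have a1 := hτ (j, 1)
    have hne : (σ (j, 0)).2 ≠ (σ (j, 1)).2 := fun h => by
      have := σ.injective (Prod.ext (hσ j) h)
      simp at this
    generalize σ (j, 0) = p at *
    generalize σ (j, 1) = q at *
    obtain ⟨p1, p2⟩ := p
    obtain ⟨q1, q2⟩ := q
    simp only at a0 a1 hne ⊢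
    subst a0 a1
    fin_cases p2 <;> fin_cases q2 <;> simp_all
  · intro σ _ hne j
    by_contra hj
    refine hne ?_
    rw [Finset.prod_eq_zero (Finset.mem_univ j) (h0 _ _ hj), mul_zero]

/-! ### Integrals of derivatives of compactly supported functions -/

section CompactlySupported

variable {n : ℕ} {U K : Set (Cn n)}

theorem fderiv_eq_zero_of_eqOn {F : Type*} [NormedAddCommGroup F] [NormedSpace ℝ F]
    {g : Cn n → F} (hU : IsOpen U) (hK : IsCompact K) (h0 : ∀ y ∈ U \ K, g y = 0)
    {y : Cn n} (hy : y ∈ U \ K) : fderiv ℝ g y = 0 := by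
  have h : g =ᶠ[𝓝 y] fun _ => 0 := by
    filter_upwards [(hU.sdiff hK.isClosed).mem_nhds hy] with z hz using h0 z hz
  rw [h.fderiv_eq]
  simp

/-- Extension by zero stays C¹: a point outside U has the open complement of K as a neighbourhood,
and the extension vanishes there. -/
theorem contDiff_indicator_of_eqOn {g : Cn n → ℂ} (hU : IsOpen U) (hK : IsCompact K) (hKU : K ⊆ U)
    (hg : ContDiffOn ℝ 1 g U) (h0 : ∀ y ∈ U \ K, g y = 0) : ContDiff ℝ 1 (U.indicator g) := by
  rw [contDiff_iff_contDiffAt]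
  intro y
  by_cases hy : y ∈ U
  · refine (hg.contDiffAt (hU.mem_nhds hy)).congr_of_eventuallyEq ?_
    filter_upwards [hU.mem_nhds hy] with z hz using indicator_of_mem hz g
  · refine (contDiffAt_const (c := (0 : ℂ))).congr_of_eventuallyEq ?_
    filter_upwards [hK.isClosed.isOpen_compl.mem_nhds fun h => hy (hKU h)] with z hz
    by_cases hzU : z ∈ U
    · rw [indicator_of_mem hzU, h0 z ⟨hzU, hz⟩]
    · exact indicator_of_notMem hzU g

theorem fderiv_indicator_eq {g : Cn n → ℂ} (hU : IsOpen U) (hK : IsCompact K) (hKU : K ⊆ U)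
    (h0 : ∀ y ∈ U \ K, g y = 0) (v : Cn n) :
    (fun y => fderiv ℝ (U.indicator g) y v) = U.indicator fun y => fderiv ℝ g y v := by
  funext y
  by_cases hy : y ∈ U
  · rw [indicator_of_mem hy]
    congr 1
    refine Filter.EventuallyEq.fderiv_eq ?_
    filter_upwards [hU.mem_nhds hy] with z hz using indicator_of_mem hz g
  · rw [indicator_of_notMem hy]
    have h : U.indicator g =ᶠ[𝓝 y] fun _ => 0 := by
      filter_upwards [hK.isClosed.isOpen_compl.mem_nhds fun h => hy (hKU h)] with z hz
      by_cases hzU : z ∈ U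
      · rw [indicator_of_mem hzU, h0 z ⟨hzU, hz⟩]
      · exact indicator_of_notMem hzU g
    rw [h.fderiv_eq]
    simp

theorem integrableOn_of_continuousOn_of_eq_zero {g : Cn n → ℂ} (hU : IsOpen U) (hK : IsCompact K)
    (hKU : K ⊆ U) (hg : ContinuousOn g U) (h0 : ∀ y ∈ U \ K, g y = 0) : IntegrableOn g U :=
  ((hg.mono hKU).integrableOn_compact hK).of_forall_sdiff_eq_zero hU.measurableSet h0

theorem integrableOn_fderiv {g : Cn n → ℂ} (hU : IsOpen U) (hK : IsCompact K) (hKU : K ⊆ U)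
    (hg : ContDiffOn ℝ 1 g U) (h0 : ∀ y ∈ U \ K, g y = 0) (v : Cn n) :
    IntegrableOn (fun y => fderiv ℝ g y v) U := by
  refine integrableOn_of_continuousOn_of_eq_zero hU hK hKU ?_ fun y hy => ?_
  · exact (hg.continuousOn_fderiv_of_isOpen hU le_rfl).clm_apply continuousOn_const
  · rw [fderiv_eq_zero_of_eqOn hU hK h0 hy]; rfl

theorem setIntegral_fderiv_eq_zero {g : Cn n → ℂ} (hU : IsOpen U) (hK : IsCompact K) (hKU : K ⊆ U)
    (hg : ContDiffOn ℝ 1 g U) (h0 : ∀ y ∈ U \ K, g y = 0) (v : Cn n) :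
    ∫ y in U, fderiv ℝ g y v = 0 := by
  have hG := contDiff_indicator_of_eqOn hU hK hKU hg h0
  have hI : Integrable (U.indicator g) :=
    (integrableOn_of_continuousOn_of_eq_zero hU hK hKU hg.continuousOn h0).integrable_indicator
      hU.measurableSet
  have hI' : Integrable fun y => fderiv ℝ (U.indicator g) y v := by
    rw [fderiv_indicator_eq hU hK hKU h0]
    exact (integrableOn_fderiv hU hK hKU hg h0 v).integrable_indicator hU.measurableSet
  -- Integration by parts against the constant function 1, whose derivative vanishes.
  have key := integral_mul_fderiv_eq_neg_fderiv_mul_of_integrable (𝕜 := ℂ) (μ := volume)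
    (f := fun _ : Cn n => (1 : ℂ)) (g := U.indicator g) (v := v)
    (by simp) (by simpa using hI') (by simpa using hI) (fun x _ => by fun_prop)
    (fun x _ => hG.contDiffAt.differentiableAt (by simp))
  simp only [one_mul, fderiv_fun_const, Pi.zero_apply, _root_.zero_apply, zero_mul,
    integral_zero, neg_zero] at key
  rw [← key, fderiv_indicator_eq hU hK hKU h0, integral_indicator hU.measurableSet]

end CompactlySupported

/-! ### Local calculus of forms -/

/-- The exterior derivative as a cyclic sum, the shape in which closedness enters
`sum_perm_eq_zero_of_cyclic`. -/
theorem extDeriv_two_apply {n : ℕ} {F : Type*} [NormedAddCommGroup F] [NormedSpace ℝ F]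
    {b : Cn n → Cn n [⋀^Fin 2]→L[ℝ] F} {y : Cn n} (hb : DifferentiableAt ℝ b y) (u v w : Cn n) :
    extDeriv b y ![u, v, w] = fderiv ℝ (fun z => b z ![v, w]) y u
      + fderiv ℝ (fun z => b z ![w, u]) y v + fderiv ℝ (fun z => b z ![u, v]) y w := by
  have hs : (fun z => b z ![w, u]) = fun z => - b z ![u, w] := by
    funext z
    have := (b z).map_swap ![u, w] (i := 0) (j := 1) (by decide)
    refine Eq.trans ?_ this
    change b z _ = b z _
    congr 1
    funext i; fin_cases i <;> rfl
  have e0 : (0 : Fin 3).removeNth ![u, v, w] = ![v, w] := by funext i; fin_cases i <;> rfl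
  have e1 : (1 : Fin 3).removeNth ![u, v, w] = ![u, w] := by funext i; fin_cases i <;> rfl
  have e2 : (2 : Fin 3).removeNth ![u, v, w] = ![u, v] := by funext i; fin_cases i <;> rfl
  rw [extDeriv_apply hb, Fin.sum_univ_three, hs, fderiv_fun_neg]
  simp [e0, e1, e2]

theorem dc_apply {n : ℕ} (f : Cn n → ℝ) (y v : Cn n) : dc f y ![v] = -fderiv ℝ f y (J n v) := rfl

theorem contDiffOn_dc {n : ℕ} {f : Cn n → ℝ} {U : Set (Cn n)} (hU : IsOpen U)
    (hf : ContDiffOn ℝ ∞ f U) : ContDiffOn ℝ ∞ (dc f) U := by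
  have h1 : ContDiffOn ℝ ∞ (fderiv ℝ f) U := hf.fderiv_of_isOpen hU (by simp)
  have h2 : ContDiffOn ℝ ∞ (fun y => -(fderiv ℝ f y ∘L J n)) U :=
    (h1.clm_comp contDiffOn_const).neg
  let L : (Cn n →L[ℝ] ℝ) →L[ℝ] (Cn n [⋀^Fin 1]→L[ℝ] ℝ) :=
    ((ContinuousAlternatingMap.ofSubsingletonLIE (𝕜 := ℝ) (E := Cn n) (F := ℝ)
      (0 : Fin 1)).toContinuousLinearEquiv : _ →L[ℝ] _)
  exact L.contDiff.comp_contDiffOn h2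

theorem contDiffOn_ddbarLocal {n : ℕ} {f : Cn n → ℝ} {U : Set (Cn n)} (hU : IsOpen U)
    (hf : ContDiffOn ℝ ∞ f U) : ContDiffOn ℝ ∞ (ddbarLocal f) U := by
  have h1 : ContDiffOn ℝ ∞ (fderiv ℝ (dc f)) U :=
    (contDiffOn_dc hU hf).fderiv_of_isOpen hU (by simp)
  let L : (Cn n →L[ℝ] Cn n [⋀^Fin 1]→L[ℝ] ℝ) →L[ℝ] (Cn n [⋀^Fin 2]→L[ℝ] ℝ) :=
    ContinuousAlternatingMap.alternatizeUncurryFinCLM ℝ (Cn n) ℝ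
  have h2 : ContDiffOn ℝ ∞ (extDeriv (dc f)) U := by
    have h3 := L.contDiff.comp_contDiffOn h1 (n := ∞)
    exact h3
  exact contDiffOn_const.smul h2 (f := fun _ => (1 / 2 : ℝ))

theorem extDeriv_ddbarLocal {n : ℕ} {f : Cn n → ℝ} {U : Set (Cn n)} (hU : IsOpen U)
    (hf : ContDiffOn ℝ ∞ f U) {y : Cn n} (hy : y ∈ U) : extDeriv (ddbarLocal f) y = 0 := by
  have : ddbarLocal f = (1 / 2 : ℝ) • extDeriv (dc f) := rfl
  rw [this, extDeriv_smul, extDeriv_extDeriv_apply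
    (((contDiffOn_dc hU hf).contDiffAt (hU.mem_nhds hy))) (by simpa using ENat.LEInfty.out), smul_zero]

theorem ddbarLocal_apply {n : ℕ} {f : Cn n → ℝ} {U : Set (Cn n)} (hU : IsOpen U)
    (hf : ContDiffOn ℝ ∞ f U) {y : Cn n} (hy : y ∈ U) (v w : Cn n) :
    ddbarLocal f y ![v, w] = (fderiv ℝ (fun z => dc f z ![w]) y v
      - fderiv ℝ (fun z => dc f z ![v]) y w) / 2 := by
  have hd : DifferentiableAt ℝ (dc f) y :=
    ((contDiffOn_dc hU hf).contDiffAt (hU.mem_nhds hy)).differentiableAt (by simp)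
  have e0 : (0 : Fin 2).removeNth ![v, w] = ![w] := by funext i; fin_cases i; rfl
  have e1 : (1 : Fin 2).removeNth ![v, w] = ![v] := by funext i; fin_cases i; rfl
  simp only [ddbarLocal, ContinuousAlternatingMap.smul_apply]
  rw [extDeriv_apply hd, Fin.sum_univ_two]
  simp only [e0, e1]
  simp
  ring

/-- **Stokes' theorem** in `ℂ³` for the form `√-1 ∂∂̄ f ∧ b ∧ c`, where `f` has compact support and
`b` and `c` are closed. -/
theorem setIntegral_tri_ddbarLocal {U K : Set (Cn 3)} (hU : IsOpen U) (hK : IsCompact K)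
    (hKU : K ⊆ U) {f : Cn 3 → ℝ} (hf : ContDiffOn ℝ ∞ f U) (hf0 : ∀ y ∈ U \ K, f y = 0)
    {b c : Cn 3 → Cn 3 [⋀^Fin 2]→L[ℝ] ℂ}
    (hb : ContDiffOn ℝ ∞ b U) (hb' : ∀ y ∈ U, extDeriv b y = 0)
    (hc : ContDiffOn ℝ ∞ c U) (hc' : ∀ y ∈ U, extDeriv c y = 0) (v : Fin 3 × Fin 2 → Cn 3) :
    ∫ y in U, tri (fun p q => (ddbarLocal f y ![v p, v q] : ℂ)) (fun p q => b y ![v p, v q])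
      (fun p q => c y ![v p, v q]) = 0 := by
  have comp : ∀ {b : Cn 3 → Cn 3 [⋀^Fin 2]→L[ℝ] ℂ}, ContDiffOn ℝ ∞ b U →
      ∀ w : Fin 2 → Cn 3, ContDiffOn ℝ ∞ (fun y => b y w) U := fun hb w =>
    (ContinuousAlternatingMap.apply ℝ (Cn 3) ℂ w).contDiff.comp_contDiffOn hb
  let u : Fin 3 × Fin 2 → Cn 3 → ℂ := fun q y => ((dc f y ![v q] : ℝ) : ℂ)
  have hur : ∀ q, ContDiffOn ℝ ∞ (fun y => dc f y ![v q]) U := fun q =>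
    (ContinuousAlternatingMap.apply ℝ (Cn 3) ℝ ![v q]).contDiff.comp_contDiffOn (contDiffOn_dc hU hf)
  have hu : ∀ q, ContDiffOn ℝ ∞ (u q) U := fun q =>
    Complex.ofRealCLM.contDiff.comp_contDiffOn (hur q)
  have hu0 : ∀ q, ∀ y ∈ U \ K, u q y = 0 := fun q y hy => by
    simp only [u, dc_apply, fderiv_eq_zero_of_eqOn hU hK hf0 hy]
    simp
  -- The terms of the 5-form dᶜf ∧ b ∧ c, whose exterior derivative is the integrand up to a factor.
  let g : Equiv.Perm (Fin 3 × Fin 2) → Cn 3 → ℂ := fun σ y =>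
    u (σ (0, 1)) y * b y ![v (σ (1, 0)), v (σ (1, 1))] * c y ![v (σ (2, 0)), v (σ (2, 1))]
  have hg : ∀ σ, ContDiffOn ℝ 1 (g σ) U := fun σ =>
    (((hu _).mul (comp hb _)).mul (comp hc _)).of_le (by simp)
  have hg0 : ∀ σ, ∀ y ∈ U \ K, g σ y = 0 := fun σ y hy => by
    simp only [g, hu0 _ y hy, zero_mul]
  have main : ∀ y ∈ U, tri (fun p q => (ddbarLocal f y ![v p, v q] : ℂ))
      (fun p q => b y ![v p, v q]) (fun p q => c y ![v p, v q])
      = ∑ σ : Equiv.Perm (Fin 3 × Fin 2), ((Equiv.Perm.sign σ : ℤ) : ℂ) *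
        fderiv ℝ (g σ) y (v (σ (0, 0))) := by
    intro y hy
    have hUy := hU.mem_nhds hy
    have hud : ∀ q, DifferentiableAt ℝ (u q) y := fun q =>
      ((hu q).contDiffAt hUy).differentiableAt (by simp)
    have hbd : DifferentiableAt ℝ b y := (hb.contDiffAt hUy).differentiableAt (by simp)
    have hcd : DifferentiableAt ℝ c y := (hc.contDiffAt hUy).differentiableAt (by simp)
    have hbd' : ∀ w, DifferentiableAt ℝ (fun y => b y w) y := fun w =>
      hbd.continuousAlternatingMap_apply_const w
    have hcd' : ∀ w, DifferentiableAt ℝ (fun y => c y w) y := fun w =>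
      hcd.continuousAlternatingMap_apply_const w
    have hN : (fun p q => (ddbarLocal f y ![v p, v q] : ℂ))
        = fun p q => (fderiv ℝ (u q) y (v p) - fderiv ℝ (u p) y (v q)) / 2 := by
      have hfu : ∀ q w, fderiv ℝ (u q) y w = (fderiv ℝ (fun z => dc f z ![v q]) y w : ℂ) := by
        intro q w
        have := (Complex.ofRealCLM.hasFDerivAt.comp y
          (((hur q).contDiffAt hUy).differentiableAt (by simp)).hasFDerivAt).fderiv
        exact congrArg (fun L => L w) this
      funext p q
      rw [ddbarLocal_apply hU hf hy, hfu, hfu]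
      push_cast
      ring
    rw [hN, tri_antisymm (fun p q => fderiv ℝ (u q) y (v p))]
    -- The Leibniz terms in which b or c is differentiated sum to zero by closedness. Adding them
    -- completes the integrand to a sum of derivatives of the functions g σ.
    have z1 := sum_perm_eq_zero_of_cyclic (fun q => u q y) (fun p q => c y ![v p, v q])
      (fun p q r => fderiv ℝ (fun z => b z ![v q, v r]) y (v p)) (fun p q r => by
        rw [← extDeriv_two_apply hbd, hb' y hy]; rfl)
    have z2 := sum_perm_eq_zero_of_cyclic' (fun q => u q y) (fun p q => b y ![v p, v q])
      (fun p q r => fderiv ℝ (fun z => c z ![v q, v r]) y (v p)) (fun p q r => by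
        rw [← extDeriv_two_apply hcd, hc' y hy]; rfl)
    rw [← add_zero (tri _ _ _), ← z1, ← add_zero (tri _ _ _ + _), ← z2, tri,
      ← Finset.sum_add_distrib, ← Finset.sum_add_distrib]
    refine Finset.sum_congr rfl fun σ _ => ?_
    have h1 := ((hud (σ (0, 1))).hasFDerivAt.mul
      (hbd' ![v (σ (1, 0)), v (σ (1, 1))]).hasFDerivAt).mul
      (hcd' ![v (σ (2, 0)), v (σ (2, 1))]).hasFDerivAt
    have h2 := congrArg (fun L => L (v (σ (0, 0)))) h1.fderiv
    have h3 : fderiv ℝ (g σ) y (v (σ (0, 0))) = _ := h2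
    rw [h3]
    simp
    ring
  rw [setIntegral_congr_fun hU.measurableSet main, integral_finsetSum]
  · refine Finset.sum_eq_zero fun σ _ => ?_
    rw [integral_const_mul, setIntegral_fderiv_eq_zero hU hK hKU (hg σ) (hg0 σ), mul_zero]
  · intro σ _
    exact (integrableOn_fderiv hU hK hKU (hg σ) (hg0 σ) _).const_mul _

/-! ### Top forms and complex linear maps -/

/-- The vectors `realBasis n` as a basis. -/
def realBasisBasis (n : ℕ) : Module.Basis (Fin n × Fin 2) ℝ (Cn n) :=
  Complex.basisOneI.smulTower' (Pi.basisFun ℂ (Fin n))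

theorem coe_realBasisBasis (n : ℕ) : ⇑(realBasisBasis n) = realBasis n := by
  funext ⟨j, b⟩
  rw [realBasisBasis, Module.Basis.smulTower'_apply]
  funext k
  fin_cases b <;>
    simp [realBasis, Complex.coe_basisOneI, Pi.single_apply, Pi.basisFun_apply]

theorem topForm_apply {n : ℕ} (Ω : Cn n [⋀^(Fin n × Fin 2)]→ₗ[ℝ] ℂ) (v : Fin n × Fin 2 → Cn n) :
    Ω v = ((realBasisBasis n).det v : ℂ) * Ω (realBasis n) := by
  -- The determinant formula is for real-valued forms, so it is applied to real and imaginary parts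
  -- separately.
  have h : ∀ L : ℂ →ₗ[ℝ] ℝ, L (Ω v) = (realBasisBasis n).det v * L (Ω (realBasis n)) := fun L => by
    have := AlternatingMap.eq_smul_basis_det (realBasisBasis n) (L.compAlternatingMap Ω)
    have h2 := congrArg (fun f => f v) this
    simp only [LinearMap.compAlternatingMap_apply, AlternatingMap.smul_apply, smul_eq_mul,
      coe_realBasisBasis] at h2
    rw [h2, mul_comm]
  apply Complex.ext
  · simpa using h Complex.reLm
  · simpa using h Complex.imLm

/-- A complex linear map multiplies a top form by the square of the modulus of its determinant. -/
theorem topForm_comp {n : ℕ} (Ω : Cn n [⋀^(Fin n × Fin 2)]→ₗ[ℝ] ℂ) (g : Cn n →ₗ[ℂ] Cn n) :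
    Ω (fun p => g (realBasis n p)) = (Complex.normSq (LinearMap.det g) : ℂ) * Ω (realBasis n) := by
  rw [topForm_apply]
  congr 2
  have h := (realBasisBasis n).det_comp (g.restrictScalars ℝ) (realBasisBasis n)
  rw [Module.Basis.det_self, mul_one, LinearMap.det_restrictScalars,
    Algebra.norm_complex_apply] at h
  rw [← h, coe_realBasisBasis]
  rfl

/-! ### Hermitian forms -/

section Hermitian

variable {n : ℕ}

theorem twoForm_swap {F : Type*} [NormedAddCommGroup F] [NormedSpace ℝ F]
    (α : Cn n [⋀^Fin 2]→L[ℝ] F) (v w : Cn n) : α ![w, v] = -α ![v, w] := by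
  refine Eq.trans ?_ (α.map_swap ![v, w] (i := 0) (j := 1) (by decide))
  change α _ = α _
  congr 1
  funext i; fin_cases i <;> rfl

theorem update_pair_zero {V : Type*} (z v w : V) :
    Function.update ![v, w] 0 z = ![z, w] := by
  funext i; fin_cases i <;> rfl

theorem twoForm_add_left (α : Cn n [⋀^Fin 2]→L[ℝ] ℝ) (v v' w : Cn n) :
    α ![v + v', w] = α ![v, w] + α ![v', w] := by
  have := α.map_update_add ![v, w] 0 v v'
  rwa [update_pair_zero, update_pair_zero, update_pair_zero] at this

theorem twoForm_smul_left (α : Cn n [⋀^Fin 2]→L[ℝ] ℝ) (r : ℝ) (v w : Cn n) :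
    α ![r • v, w] = r * α ![v, w] := by
  have := α.map_update_smul ![v, w] 0 r v
  rwa [update_pair_zero, update_pair_zero] at this

theorem J_apply (v : Cn n) : J n v = Complex.I • v := rfl

theorem J_J (v : Cn n) : J n (J n v) = -v := by
  rw [J_apply, J_apply, smul_smul, Complex.I_mul_I, neg_one_smul]

/-- The Hermitian form `∑ a_{jk} vⱼ w̄ₖ` of the real `(1,1)`-form `√-1 ∑ a_{jk} dzⱼ ∧ dz̄ₖ`. -/
def hermitianForm (α : Cn n [⋀^Fin 2]→L[ℝ] ℝ) (v w : Cn n) : ℂ :=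
  ((α ![v, J n w] : ℂ) - Complex.I * (α ![v, w] : ℂ)) / 2

theorem hermitianForm_add_left (α : Cn n [⋀^Fin 2]→L[ℝ] ℝ) (v v' w : Cn n) :
    hermitianForm α (v + v') w = hermitianForm α v w + hermitianForm α v' w := by
  simp only [hermitianForm, twoForm_add_left]; push_cast; ring

theorem twoForm_J_left {α : Cn n [⋀^Fin 2]→L[ℝ] ℝ}
    (hα : ∀ v w, α ![J n v, J n w] = α ![v, w]) (v w : Cn n) : α ![J n v, w] = -α ![v, J n w] := by
  have := hα (J n v) w
  rw [J_J, ← neg_one_smul ℝ v, twoForm_smul_left] at this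
  linarith

/-- Complex linearity in the first slot is where type (1,1) is used: invariance under √-1 moves J
from the first argument to the second with a sign. -/
theorem hermitianForm_smul_left {α : Cn n [⋀^Fin 2]→L[ℝ] ℝ}
    (hα : ∀ v w, α ![J n v, J n w] = α ![v, w]) (c : ℂ) (v w : Cn n) :
    hermitianForm α (c • v) w = c * hermitianForm α v w := by
  have hc : c • v = c.re • v + c.im • J n v := by
    rw [J_apply, ← Complex.coe_smul, ← Complex.coe_smul, smul_smul, ← add_smul, Complex.re_add_im]
  rw [hc]
  simp only [hermitianForm, twoForm_add_left, twoForm_smul_left, hα, twoForm_J_left hα v w]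
  conv_rhs => rw [← Complex.re_add_im c]
  push_cast
  linear_combination ((c.im : ℂ) * (α ![v, w]) / 2) * Complex.I_mul_I

theorem hermitianForm_conj {α : Cn n [⋀^Fin 2]→L[ℝ] ℝ}
    (hα : ∀ v w, α ![J n v, J n w] = α ![v, w]) (v w : Cn n) :
    (starRingEnd ℂ) (hermitianForm α v w) = hermitianForm α w v := by
  have h1 : α ![w, J n v] = α ![v, J n w] := by
    rw [twoForm_swap, twoForm_J_left hα, neg_neg]
  simp only [hermitianForm, h1, twoForm_swap α v w, map_div₀, map_sub, map_mul, Complex.conj_ofReal,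
    Complex.conj_I, map_ofNat]
  push_cast; ring

theorem hermitianForm_eq_sum {α : Cn n [⋀^Fin 2]→L[ℝ] ℝ}
    (hα : ∀ v w, α ![J n v, J n w] = α ![v, w]) (v w : Cn n) :
    hermitianForm α v w
      = ∑ j, ∑ k, v j * coeffMatrix α j k * (starRingEnd ℂ) (w k) := by
  have hsum : ∀ (w' : Cn n) (u : Cn n), hermitianForm α u w'
      = ∑ j, u j * hermitianForm α (Pi.single j 1) w' := by
    intro w' u
    let L : Cn n →ₗ[ℂ] ℂ :=
      { toFun := fun v => hermitianForm α v w'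
        map_add' := fun v v' => hermitianForm_add_left α v v' w'
        map_smul' := fun c v => hermitianForm_smul_left hα c v w' }
    have h := congrArg L (pi_eq_sum_univ' u)
    rw [map_sum] at h
    refine h.trans (Finset.sum_congr rfl fun j _ => ?_)
    rw [L.map_smul, smul_eq_mul]
    congr 2
  rw [hsum w v]
  refine Finset.sum_congr rfl fun j _ => ?_
  rw [← hermitianForm_conj hα, hsum, map_sum, Finset.mul_sum]
  refine Finset.sum_congr rfl fun k _ => ?_
  rw [map_mul, hermitianForm_conj hα]
  have hJ : J n (Pi.single k 1) = Pi.single k Complex.I := by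
    rw [J_apply, ← Pi.single_smul, smul_eq_mul, mul_one]
  have hc : hermitianForm α (Pi.single j 1) (Pi.single k 1) = coeffMatrix α j k := by
    simp only [hermitianForm, coeffMatrix, Matrix.of_apply, hJ]
  rw [hc]; ring

theorem coeffMatrix_isHermitian {α : Cn n [⋀^Fin 2]→L[ℝ] ℝ}
    (hα : ∀ v w, α ![J n v, J n w] = α ![v, w]) : (coeffMatrix α).IsHermitian := by
  have hJ : ∀ k, J n (Pi.single k 1) = Pi.single k Complex.I := fun k => by
    rw [J_apply, ← Pi.single_smul, smul_eq_mul, mul_one]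
  have hc : ∀ j k, hermitianForm α (Pi.single j 1) (Pi.single k 1) = coeffMatrix α j k := by
    intro j k
    simp only [hermitianForm, coeffMatrix, Matrix.of_apply, hJ]
  ext j k
  rw [Matrix.conjTranspose_apply, ← hc, ← hc]
  exact hermitianForm_conj hα _ _

theorem hermitianForm_self {α : Cn n [⋀^Fin 2]→L[ℝ] ℝ} (v : Cn n) :
    hermitianForm α v v = ((α ![v, J n v] / 2 : ℝ) : ℂ) := by
  have : α ![v, v] = 0 := by
    have := twoForm_swap α v v
    linarith
  simp [hermitianForm, this]

open scoped ComplexOrder in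
theorem coeffMatrix_posDef {χ : Cn n [⋀^Fin 2]→L[ℝ] ℝ}
    (hχ : ∀ v w, χ ![J n v, J n w] = χ ![v, w]) (hpos : ∀ v ≠ 0, 0 < χ ![v, J n v]) :
    (coeffMatrix χ).PosDef := by
  refine Matrix.PosDef.of_dotProduct_mulVec_pos (coeffMatrix_isHermitian hχ) fun x hx => ?_
  -- The form is linear in the first slot and conjugate-linear in the second, so the vector matching
  -- the matrix quadratic form at x is its conjugate.
  have h1 : star x ⬝ᵥ (coeffMatrix χ).mulVec x = hermitianForm χ (star x) (star x) := by
    rw [hermitianForm_eq_sum hχ]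
    simp only [dotProduct, Matrix.mulVec, Finset.mul_sum]
    refine Finset.sum_congr rfl fun j _ => Finset.sum_congr rfl fun k _ => ?_
    simp [mul_assoc]
  rw [h1, hermitianForm_self]
  have := hpos (star x) (by simpa using hx)
  exact_mod_cast half_pos this

end Hermitian

/-! ### Simultaneous diagonalisation -/

open scoped ComplexOrder MatrixOrder in
-- Write A = S* S, diagonalise the Hermitian matrix (S⁻¹)* B S⁻¹ by a unitary V, and take P = S⁻¹ V.
theorem exists_simultaneous_diagonalization {n : ℕ} {A B : Matrix (Fin n) (Fin n) ℂ}
    (hA : A.PosDef) (hB : B.IsHermitian) :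
    ∃ (P : Matrix (Fin n) (Fin n) ℂ) (l : Fin n → ℝ), IsUnit P ∧
      P.conjTranspose * A * P = 1 ∧
      P.conjTranspose * B * P = Matrix.diagonal (fun j => (l j : ℂ)) ∧
      (A⁻¹ * B).charpoly.roots = Finset.univ.val.map (fun j => (l j : ℂ)) := by
  obtain ⟨S, hS⟩ := CStarAlgebra.nonneg_iff_eq_star_mul_self.mp hA.posSemidef.nonneg
  have hSu : IsUnit S := by
    have h := hA.isUnit
    rw [hS, Matrix.isUnit_iff_isUnit_det, Matrix.det_mul] at h
    exact (Matrix.isUnit_iff_isUnit_det _).2 (isUnit_of_mul_isUnit_right h)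
  have hSd := (Matrix.isUnit_iff_isUnit_det _).1 hSu
  have hM : (S⁻¹.conjTranspose * B * S⁻¹).IsHermitian :=
    Matrix.isHermitian_conjTranspose_mul_mul _ hB
  let V : Matrix (Fin n) (Fin n) ℂ := hM.eigenvectorUnitary
  have hV : V.conjTranspose * V = 1 := Unitary.coe_star_mul_self hM.eigenvectorUnitary
  have hD : V.conjTranspose * (S⁻¹.conjTranspose * B * S⁻¹) * V
      = Matrix.diagonal (fun j => (hM.eigenvalues j : ℂ)) := by
    have := hM.conjStarAlgAut_star_eigenvectorUnitary
    rw [Unitary.conjStarAlgAut_star_apply] at this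
    exact this
  have hVu : IsUnit V := IsUnit.of_mul_eq_one_right _ hV
  have h1 : (S⁻¹ * V).conjTranspose * A * (S⁻¹ * V) = 1 := by
    rw [hS, Matrix.conjTranspose_mul, Matrix.star_eq_conjTranspose]
    calc V.conjTranspose * S⁻¹.conjTranspose * (S.conjTranspose * S) * (S⁻¹ * V)
        = V.conjTranspose * (S * S⁻¹).conjTranspose * (S * S⁻¹) * V := by
          simp only [Matrix.conjTranspose_mul, Matrix.mul_assoc]
      _ = 1 := by
          rw [Matrix.mul_nonsing_inv _ hSd, Matrix.conjTranspose_one, Matrix.mul_one,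
            Matrix.mul_one, hV]
  have h2 : (S⁻¹ * V).conjTranspose * B * (S⁻¹ * V)
      = Matrix.diagonal (fun j => (hM.eigenvalues j : ℂ)) := by
    rw [← hD, Matrix.conjTranspose_mul]
    simp only [Matrix.mul_assoc]
  have hPu : IsUnit (S⁻¹ * V) := (Matrix.isUnit_nonsing_inv_iff.2 hSu).mul hVu
  refine ⟨S⁻¹ * V, hM.eigenvalues, hPu, h1, h2, ?_⟩
  set P := S⁻¹ * V
  have hPd := (Matrix.isUnit_iff_isUnit_det _).1 hPu
  -- Hence A⁻¹ B = P (P* B) has the same characteristic polynomial as the diagonal matrix P* B P.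
  have hinv : A⁻¹ = P * P.conjTranspose := by
    refine Matrix.inv_eq_left_inv ?_
    have h3 : P.conjTranspose * A = P⁻¹ := by
      rw [← Matrix.mul_one (P.conjTranspose * A), ← Matrix.mul_nonsing_inv _ hPd,
        ← Matrix.mul_assoc, h1, Matrix.one_mul]
    rw [Matrix.mul_assoc, h3, Matrix.mul_nonsing_inv _ hPd]
  rw [hinv, Matrix.mul_assoc, Matrix.charpoly_mul_comm, h2, Matrix.charpoly_diagonal,
    Polynomial.roots_prod _ _ (Finset.prod_ne_zero_iff.2 fun j _ => Polynomial.X_sub_C_ne_zero _)]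
  simp

/-- The value on the standard basis of the top power of `t α + √-1 χ`, in terms of the eigenvalues
of `α` with respect to `χ`. -/
theorem exists_wedgePow_eq {χ α : Cn 3 [⋀^Fin 2]→L[ℝ] ℝ}
    (hχ : ∀ v w, χ ![J 3 v, J 3 w] = χ ![v, w]) (hpos : ∀ v ≠ 0, 0 < χ ![v, J 3 v])
    (hα : ∀ v w, α ![J 3 v, J 3 w] = α ![v, w]) :
    ∃ (C : ℝ) (a b c : ℝ), 0 < C ∧ relEigenvalues χ α = {a, b, c} ∧ ∀ t : ℝ,
      wedgePow 3 (t • Complex.ofRealCLM.compContinuousAlternatingMap α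
        + Complex.I • Complex.ofRealCLM.compContinuousAlternatingMap χ) (realBasis 3)
      = C * (((t * a : ℂ) + Complex.I) * (t * b + Complex.I) * (t * c + Complex.I)) := by
  obtain ⟨P, l, hPu, h1, h2, hroots⟩ := exists_simultaneous_diagonalization
    (coeffMatrix_posDef hχ hpos) (coeffMatrix_isHermitian hα)
  obtain ⟨C, hC, hdiag⟩ := exists_pos_tri_diagonal
  -- The conjugated columns of P: with the convention ∑ a_{jk} vⱼ w̄ₖ, the Gram matrix of this frame
  -- is P* a P.
  let f : Fin 3 → Cn 3 := fun j k => (starRingEnd ℂ) (P k j)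
  let g : Cn 3 →ₗ[ℂ] Cn 3 := Matrix.toLin' (P.map (starRingEnd ℂ))
  have hf0 : ∀ j, g (realBasis 3 (j, 0)) = f j := fun j => by
    simp only [g, realBasis, Matrix.toLin'_apply]
    funext k
    simp [f]
  have hf1 : ∀ j, g (realBasis 3 (j, 1)) = J 3 (f j) := fun j => by
    have : realBasis 3 (j, 1) = Complex.I • realBasis 3 (j, 0) := by
      simp [realBasis, ← Pi.single_smul]
    rw [this, map_smul, hf0, J_apply]
  have hh : ∀ {β : Cn 3 [⋀^Fin 2]→L[ℝ] ℝ}, (∀ v w, β ![J 3 v, J 3 w] = β ![v, w]) →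
      ∀ j k, hermitianForm β (f j) (f k) = (P.conjTranspose * coeffMatrix β * P) j k := by
    intro β hβ j k
    rw [hermitianForm_eq_sum hβ, Finset.sum_comm]
    simp [Matrix.mul_apply, f, Finset.sum_mul]
  have hval : ∀ {β : Cn 3 [⋀^Fin 2]→L[ℝ] ℝ} {m : Fin 3 → ℝ},
      (∀ v w, β ![J 3 v, J 3 w] = β ![v, w]) →
      P.conjTranspose * coeffMatrix β * P = Matrix.diagonal (fun j => (m j : ℂ)) →
      ∀ j k, β ![f j, f k] = 0 ∧ β ![f j, J 3 (f k)] = if j = k then 2 * m j else 0 := by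
    intro β m hβ hm j k
    have h := hh hβ j k
    rw [hm, Matrix.diagonal_apply] at h
    have hre := congrArg Complex.re h
    have him := congrArg Complex.im h
    simp only [hermitianForm] at hre him
    split_ifs at hre him ⊢ with hjk <;> simp at hre him <;> exact ⟨by linarith, by linarith⟩
  have hχv := hval hχ (m := fun _ => 1) (by rw [h1]; simp)
  have hαv := hval hα h2
  have hdet : 0 < Complex.normSq (LinearMap.det g) := by
    rw [Complex.normSq_pos]
    have hd := (Matrix.isUnit_iff_isUnit_det _).1 hPu
    simp only [g, LinearMap.det_toLin']
    have : (P.map (starRingEnd ℂ)).det = (starRingEnd ℂ) P.det := (RingHom.map_det _ _).symm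
    rw [this]
    simpa using hd.ne_zero
  -- Dividing by |det g|² returns from the diagonalising frame to the standard one.
  refine ⟨C / Complex.normSq (LinearMap.det g), l 0, l 1, l 2, by positivity, ?_, fun t => ?_⟩
  · rw [relEigenvalues, hroots, Multiset.map_map]
    rfl
  have hcomp := topForm_comp (wedgePow 3 (t • Complex.ofRealCLM.compContinuousAlternatingMap α
        + Complex.I • Complex.ofRealCLM.compContinuousAlternatingMap χ)) g
  -- The Hermitian form is half of α(v, J w), hence the factor 2; its cube cancels the 1/8 in
  -- `wedgePow_three_apply`.
  have htri := hdiag (fun j => 2 * ((t * l j : ℂ) + Complex.I)) (fun p q =>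
    (t • Complex.ofRealCLM.compContinuousAlternatingMap α
        + Complex.I • Complex.ofRealCLM.compContinuousAlternatingMap χ)
      ![g (realBasis 3 p), g (realBasis 3 q)])
  have hev : ∀ v w, (t • Complex.ofRealCLM.compContinuousAlternatingMap α
        + Complex.I • Complex.ofRealCLM.compContinuousAlternatingMap χ) ![v, w]
      = (t : ℂ) * (α ![v, w] : ℝ) + Complex.I * (χ ![v, w] : ℝ) := fun v w => by
    simp
  have hJl : ∀ j k, α ![J 3 (f j), f k] = -α ![f j, J 3 (f k)] := fun j k =>
    twoForm_J_left hα _ _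
  have hJl' : ∀ j k, χ ![J 3 (f j), f k] = -χ ![f j, J 3 (f k)] := fun j k =>
    twoForm_J_left hχ _ _
  rw [wedgePow_three_apply, htri] at hcomp
  · rw [Fin.prod_univ_three] at hcomp
    have hne : (Complex.normSq (LinearMap.det g) : ℂ) ≠ 0 := by exact_mod_cast hdet.ne'
    push_cast
    rw [div_mul_eq_mul_div, eq_div_iff hne]
    linear_combination -hcomp
  · rintro ⟨j, b⟩ ⟨k, b'⟩ hjk
    simp only at hjk
    rw [hev]
    fin_cases b <;> fin_cases b' <;>
      simp [hf0, hf1, hα, hχ, hJl, hJl', (hαv _ _).1, (hαv _ _).2, (hχv _ _).1, (hχv _ _).2, hjk]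
  · intro j
    rw [hev, hf0, hf1, (hαv _ _).2, (hχv _ _).2]
    simp; ring
  · intro j
    rw [hev, hf0, hf1, hJl, hJl', (hαv _ _).2, (hχv _ _).2]
    simp; ring

/-! ### The operator `√-1 ∂∂̄` under holomorphic maps -/

section Holomorphic

variable {n : ℕ}

theorem fderiv_real_apply_smul {h : Cn n → Cn n} {y : Cn n} (hh : DifferentiableAt ℂ h y)
    (v : Cn n) : fderiv ℝ h y (J n v) = J n (fderiv ℝ h y v) := by
  rw [hh.fderiv_restrictScalars ℝ, J_apply, J_apply]
  exact (fderiv ℂ h y).map_smul _ _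

theorem dc_comp {f : Cn n → ℝ} {h : Cn n → Cn n} {y : Cn n} (hf : DifferentiableAt ℝ f (h y))
    (hh : DifferentiableAt ℂ h y) :
    dc (f ∘ h) y = (dc f (h y)).compContinuousLinearMap (fderiv ℝ h y) := by
  ext v
  have h1 : dc (f ∘ h) y v = -fderiv ℝ (f ∘ h) y (J n (v 0)) := rfl
  have h2 : (dc f (h y)).compContinuousLinearMap (fderiv ℝ h y) v
    = -fderiv ℝ f (h y) (J n (fderiv ℝ h y (v 0))) := rfl
  rw [h1, h2, fderiv_comp y hf (hh.restrictScalars ℝ), ContinuousLinearMap.comp_apply,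
    fderiv_real_apply_smul hh]

/-- Holomorphic derivatives commute with √-1, so pullback commutes with dᶜ; it always commutes with
d. -/
theorem ddbarLocal_comp {f : Cn n → ℝ} {h : Cn n → Cn n} {U W : Set (Cn n)} (hU : IsOpen U)
    (hW : IsOpen W) (hf : ContDiffOn ℝ ∞ f W) (hh : ContDiffOn ℂ ω h U) (hUW : MapsTo h U W)
    {y : Cn n} (hy : y ∈ U) :
    ddbarLocal (f ∘ h) y = (ddbarLocal f (h y)).compContinuousLinearMap (fderiv ℝ h y) := by
  have hev : dc (f ∘ h) =ᶠ[𝓝 y] fun z => (dc f (h z)).compContinuousLinearMap (fderiv ℝ h z) := by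
    filter_upwards [hU.mem_nhds hy] with z hz
    exact dc_comp ((hf.contDiffAt (hW.mem_nhds (hUW hz))).differentiableAt (by simp))
      ((hh.contDiffAt (hU.mem_nhds hz)).differentiableAt (by simp))
  have hd : DifferentiableAt ℝ (dc f) (h y) :=
    ((contDiffOn_dc hW hf).contDiffAt (hW.mem_nhds (hUW hy))).differentiableAt (by simp)
  rw [ddbarLocal, hev.extDeriv_eq, extDeriv_pullback (r := ω) hd
    ((hh.contDiffAt (hU.mem_nhds hy)).restrict_scalars ℝ) (by simp)]
  rfl

/-- By symmetry of the Hessian H: the form is (H(w, J v) - H(v, J w)) / 2. -/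
theorem ddbarLocal_J {f : Cn n → ℝ} {U : Set (Cn n)} (hU : IsOpen U) (hf : ContDiffOn ℝ ∞ f U)
    {y : Cn n} (hy : y ∈ U) (v w : Cn n) :
    ddbarLocal f y ![J n v, J n w] = ddbarLocal f y ![v, w] := by
  have hfy := hf.contDiffAt (hU.mem_nhds hy)
  have hd : DifferentiableAt ℝ (fderiv ℝ f) y :=
    (((hf.fderiv_of_isOpen (m := ∞) hU (by simp))).contDiffAt (hU.mem_nhds hy)).differentiableAt
      (by simp)
  have hdc : ∀ u w, fderiv ℝ (fun z => dc f z ![w]) y u = -fderiv ℝ (fderiv ℝ f) y u (J n w) := by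
    intro u w
    simp only [dc_apply]
    rw [fderiv_fun_neg, _root_.neg_apply, fderiv_clm_apply hd (by fun_prop)]
    simp
  have hsymm : ∀ u w, fderiv ℝ (fderiv ℝ f) y u w = fderiv ℝ (fderiv ℝ f) y w u :=
    fun u w => hfy.isSymmSndFDerivAt (by simpa using ENat.LEInfty.out) u w
  rw [ddbarLocal_apply hU hf hy, ddbarLocal_apply hU hf hy, hdc, hdc, hdc, hdc, J_J, J_J,
    map_neg, map_neg, hsymm w, hsymm v]
  ring

end Holomorphic

theorem twoForm_comp_pair {V W F : Type*} [AddCommGroup V] [Module ℝ V] [TopologicalSpace V]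
    [AddCommGroup W] [Module ℝ W] [TopologicalSpace W] [AddCommGroup F] [Module ℝ F]
    [TopologicalSpace F] (β : W [⋀^Fin 2]→L[ℝ] F) (L : V →L[ℝ] W) (v w : V) :
    β.compContinuousLinearMap L ![v, w] = β ![L v, L w] := by
  change β _ = β _
  congr 1
  funext i; fin_cases i <;> rfl

/-! ### Changes of charts -/

theorem mem_transition_source {n : ℕ} {X : Type*} [TopologicalSpace X] {e e' : OpenPartialHomeomorph X (Cn n)} {y : Cn n} : y ∈ (e.symm.trans e').source ↔
    y ∈ e.target ∧ e.symm y ∈ e'.source := by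
  simp

section Charts

variable {n : ℕ} {X : Type*} [TopologicalSpace X] [ChartedSpace (Cn n) X]

/-- The derivative of the inverse of a chart, as an endomorphism of the model space. -/
def chartDeriv (e : OpenPartialHomeomorph X (Cn n)) (y : Cn n) : Cn n →L[ℝ] Cn n :=
  mfderiv 𝓘(ℝ, Cn n) 𝓘(ℝ, Cn n) e.symm y

/-- A 2-form at a point, as a form on the model space. -/
def modelForm {F : Type*} [NormedAddCommGroup F] [NormedSpace ℝ F] (α : TwoForm n X F) (x : X) :
    Cn n [⋀^Fin 2]→L[ℝ] F := α x

/-- A top form at a point, as a form on the model space. -/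
def modelTop (Ω : TopForm n X) (x : X) : Cn n [⋀^(Fin n × Fin 2)]→ₗ[ℝ] ℂ := Ω x

theorem localRep_eq {F : Type*} [NormedAddCommGroup F] [NormedSpace ℝ F] (α : TwoForm n X F)
    (e : OpenPartialHomeomorph X (Cn n)) (y : Cn n) :
    localRep α e y = (modelForm α (e.symm y)).compContinuousLinearMap (chartDeriv e y) := rfl

theorem topCoeff_eq (Ω : TopForm n X) (e : OpenPartialHomeomorph X (Cn n)) (y : Cn n) :
    topCoeff Ω e y = modelTop Ω (e.symm y) fun p => chartDeriv e y (realBasis n p) := rfl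

theorem localRep_add {F : Type*} [NormedAddCommGroup F] [NormedSpace ℝ F] (α β : TwoForm n X F)
    (e : OpenPartialHomeomorph X (Cn n)) (y : Cn n) :
    localRep (α + β) e y = localRep α e y + localRep β e y := rfl

/-! ### The complex-valued form `t α + √-1 χ` -/

theorem localRep_complexForm (χ α : TwoForm n X ℝ) (t : ℝ)
    (e : OpenPartialHomeomorph X (Cn n)) (y : Cn n) :
    localRep (complexForm χ α t) e y =
      t • Complex.ofRealCLM.compContinuousAlternatingMap (localRep α e y)
        + Complex.I • Complex.ofRealCLM.compContinuousAlternatingMap (localRep χ e y) := rfl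

theorem contDiffOn_localRep_complexForm {e : OpenPartialHomeomorph X (Cn n)} {χ α : TwoForm n X ℝ} (hχ : IsClosedRealOneOne χ)
    (hα : IsClosedRealOneOne α) (t : ℝ) (he : e ∈ atlas (Cn n) X) :
    ContDiffOn ℝ ∞ (localRep (complexForm χ α t) e) e.target := by
  let L : (Cn n [⋀^Fin 2]→L[ℝ] ℝ) →L[ℝ] (Cn n [⋀^Fin 2]→L[ℝ] ℂ) :=
    ContinuousLinearMap.compContinuousAlternatingMapCLM ℝ (Cn n) ℝ ℂ (Fin 2) Complex.ofRealCLM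
  have h1 := L.contDiff.comp_contDiffOn (hα.smooth e he) (n := ∞)
  have h2 := L.contDiff.comp_contDiffOn (hχ.smooth e he) (n := ∞)
  exact (h1.const_smul t).add (h2.const_smul Complex.I)

theorem extDeriv_localRep_complexForm {e : OpenPartialHomeomorph X (Cn n)} {χ α : TwoForm n X ℝ} (hχ : IsClosedRealOneOne χ)
    (hα : IsClosedRealOneOne α) (t : ℝ) (he : e ∈ atlas (Cn n) X) {y : Cn n} (hy : y ∈ e.target) :
    extDeriv (localRep (complexForm χ α t) e) y = 0 := by
  have hy' := e.open_target.mem_nhds hy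
  have hχd := ((hχ.smooth e he).contDiffAt hy').differentiableAt (by simp)
  have hαd := ((hα.smooth e he).contDiffAt hy').differentiableAt (by simp)
  have hd := ((contDiffOn_localRep_complexForm hχ hα t he).contDiffAt hy').differentiableAt
    (by simp)
  have hcomp : ∀ (p : Fin 2 → Cn n) (u : Cn n),
      fderiv ℝ (fun z => localRep (complexForm χ α t) e z p) y u
        = t * (fderiv ℝ (fun z => localRep α e z p) y u : ℝ)
          + Complex.I * (fderiv ℝ (fun z => localRep χ e z p) y u : ℝ) := by
    intro p u
    have h1 : HasFDerivAt (fun z => (localRep α e z p : ℂ)) _ y :=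
      Complex.ofRealCLM.hasFDerivAt.comp y (hαd.continuousAlternatingMap_apply_const p).hasFDerivAt
    have h2 : HasFDerivAt (fun z => (localRep χ e z p : ℂ)) _ y :=
      Complex.ofRealCLM.hasFDerivAt.comp y (hχd.continuousAlternatingMap_apply_const p).hasFDerivAt
    have h3 := (h1.const_smul (t : ℂ)).add (h2.const_smul Complex.I)
    have h4 := congrArg (fun L => L u) h3.fderiv
    exact h4
  ext v
  rw [extDeriv_apply hd]
  have hα0 := congrArg (fun L => L v) (hα.closed e he y hy)
  have hχ0 := congrArg (fun L => L v) (hχ.closed e he y hy)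
  rw [extDeriv_apply hαd] at hα0
  rw [extDeriv_apply hχd] at hχ0
  rw [Fin.sum_univ_three] at hα0 hχ0 ⊢
  rw [hcomp, hcomp, hcomp]
  simp at hα0 hχ0 ⊢
  have hα1 := congrArg (fun r : ℝ => (r : ℂ)) hα0
  have hχ1 := congrArg (fun r : ℝ => (r : ℂ)) hχ0
  push_cast at hα1 hχ1
  linear_combination (t : ℂ) * hα1 + Complex.I * hχ1

/-! ### Transition maps -/

variable [IsManifold 𝓘(ℂ, Cn n) ω X] {e e' : OpenPartialHomeomorph X (Cn n)}

theorem contDiffOn_transition (he : e ∈ atlas (Cn n) X) (he' : e' ∈ atlas (Cn n) X) :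
    ContDiffOn ℂ ω (e' ∘ e.symm) (e.symm.trans e').source := by
  have h := (contDiffGroupoid ω 𝓘(ℂ, Cn n)).compatible he he'
  rw [contDiffGroupoid, mem_groupoid_of_pregroupoid] at h
  have h1 := h.1
  simpa [contDiffPregroupoid] using h1

theorem differentiableAt_transition (he : e ∈ atlas (Cn n) X) (he' : e' ∈ atlas (Cn n) X)
    {y : Cn n} (hy : y ∈ (e.symm.trans e').source) : DifferentiableAt ℂ (e' ∘ e.symm) y :=
  ((contDiffOn_transition he he').contDiffAt
    ((e.symm.trans e').open_source.mem_nhds hy)).differentiableAt (by simp)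

theorem chartDeriv_transition (he : e ∈ atlas (Cn n) X) (he' : e' ∈ atlas (Cn n) X)
    {y : Cn n} (hy : y ∈ (e.symm.trans e').source) :
    chartDeriv e y = (chartDeriv e' (e' (e.symm y))).comp (fderiv ℝ (e' ∘ e.symm) y) := by
  have : IsManifold 𝓘(ℝ, Cn n) ∞ X := isManifold_real
  have : IsManifold 𝓘(ℝ, Cn n) 1 X := IsManifold.of_le (n := ∞) (by simp)
  obtain ⟨hy1, hy2⟩ := mem_transition_source.1 hy
  have hev : (e.symm : Cn n → X) =ᶠ[𝓝 y] e'.symm ∘ (e' ∘ e.symm) := by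
    filter_upwards [(e.symm.trans e').open_source.mem_nhds hy] with z hz
    exact (e'.left_inv (mem_transition_source.1 hz).2).symm
  have h1 : MDifferentiableAt 𝓘(ℝ, Cn n) 𝓘(ℝ, Cn n) e'.symm ((e' ∘ e.symm) y) :=
    mdifferentiableAt_atlas_symm he' (e'.map_source hy2)
  have h2 : MDifferentiableAt 𝓘(ℝ, Cn n) 𝓘(ℝ, Cn n) (e' ∘ e.symm) y :=
    ((differentiableAt_transition he he' hy).restrictScalars ℝ).mdifferentiableAt
  have h3 := mfderiv_comp y h1 h2
  rw [mfderiv_eq_fderiv] at h3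
  exact (hev.mfderiv_eq).trans h3

theorem chartDeriv_comp_mfderiv (he : e ∈ atlas (Cn n) X) (he' : e' ∈ atlas (Cn n) X)
    {y : Cn n} (hy : y ∈ (e.symm.trans e').source) :
    (mfderiv 𝓘(ℝ, Cn n) 𝓘(ℝ, Cn n) e' (e.symm y) : Cn n →L[ℝ] Cn n).comp (chartDeriv e y)
      = fderiv ℝ (e' ∘ e.symm) y := by
  have : IsManifold 𝓘(ℝ, Cn n) ∞ X := isManifold_real
  have : IsManifold 𝓘(ℝ, Cn n) 1 X := IsManifold.of_le (n := ∞) (by simp)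
  obtain ⟨hy1, hy2⟩ := mem_transition_source.1 hy
  have h1 : MDifferentiableAt 𝓘(ℝ, Cn n) 𝓘(ℝ, Cn n) e' (e.symm y) :=
    mdifferentiableAt_atlas he' hy2
  have h2 : MDifferentiableAt 𝓘(ℝ, Cn n) 𝓘(ℝ, Cn n) e.symm y :=
    mdifferentiableAt_atlas_symm he hy1
  have h3 := mfderiv_comp y h1 h2
  rw [mfderiv_eq_fderiv] at h3
  exact h3.symm

/-- The Jacobian of a change of charts, a positive number. -/
def jacobian (e e' : OpenPartialHomeomorph X (Cn n)) (y : Cn n) : ℝ :=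
  Complex.normSq (LinearMap.det (fderiv ℂ (e' ∘ e.symm) y : Cn n →ₗ[ℂ] Cn n))

/-- A holomorphic change of charts rescales top coefficients by |det|², so half-plane conditions on
them do not depend on the chart. -/
theorem topCoeff_transition (Ω : TopForm n X) (he : e ∈ atlas (Cn n) X)
    (he' : e' ∈ atlas (Cn n) X) {y : Cn n} (hy : y ∈ (e.symm.trans e').source) :
    topCoeff Ω e y = jacobian e e' y * topCoeff Ω e' (e' (e.symm y)) := by
  rw [topCoeff_eq, topCoeff_eq, e'.left_inv (mem_transition_source.1 hy).2,
    chartDeriv_transition he he' hy,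
    (differentiableAt_transition he he' hy).fderiv_restrictScalars ℝ]
  exact topForm_comp ((modelTop Ω (e.symm y)).compLinearMap
    (chartDeriv e' (e' (e.symm y)) : Cn n →ₗ[ℝ] Cn n)) (fderiv ℂ (e' ∘ e.symm) y : Cn n →ₗ[ℂ] Cn n)

theorem det_fderiv_transition (he : e ∈ atlas (Cn n) X) (he' : e' ∈ atlas (Cn n) X)
    {y : Cn n} (hy : y ∈ (e.symm.trans e').source) :
    (fderiv ℝ (e' ∘ e.symm) y).det = jacobian e e' y := by
  rw [(differentiableAt_transition he he' hy).fderiv_restrictScalars ℝ, jacobian,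
    ← Algebra.norm_complex_apply, ← LinearMap.det_restrictScalars]
  rfl

theorem jacobian_pos (he : e ∈ atlas (Cn n) X) (he' : e' ∈ atlas (Cn n) X)
    {y : Cn n} (hy : y ∈ (e.symm.trans e').source) : 0 < jacobian e e' y := by
  obtain ⟨hy1, hy2⟩ := mem_transition_source.1 hy
  have hy' : e' (e.symm y) ∈ (e'.symm.trans e).source := by
    rw [mem_transition_source, e'.left_inv hy2]
    exact ⟨e'.map_source hy2, e.map_target hy1⟩
  -- The opposite transition inverts this one near y, so the complex determinant is nonzero.
  have hev : (e ∘ e'.symm) ∘ (e' ∘ e.symm) =ᶠ[𝓝 y] id := by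
    filter_upwards [(e.symm.trans e').open_source.mem_nhds hy] with z hz
    obtain ⟨hz1, hz2⟩ := mem_transition_source.1 hz
    simp [e'.left_inv hz2, e.right_inv hz1]
  have h1 : (fderiv ℂ (e ∘ e'.symm) (e' (e.symm y))).comp (fderiv ℂ (e' ∘ e.symm) y)
      = ContinuousLinearMap.id ℂ (Cn n) := by
    rw [← fderiv_id (x := y), ← hev.fderiv_eq]
    exact (fderiv_comp y (differentiableAt_transition he' he hy')
      (differentiableAt_transition he he' hy)).symm
  have h2 : LinearMap.det (fderiv ℂ (e ∘ e'.symm) (e' (e.symm y)) : Cn n →ₗ[ℂ] Cn n)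
      * LinearMap.det (fderiv ℂ (e' ∘ e.symm) y : Cn n →ₗ[ℂ] Cn n) = 1 := by
    rw [← LinearMap.det_comp, ← ContinuousLinearMap.toLinearMap_comp, h1]
    exact LinearMap.det_id
  exact Complex.normSq_pos.2 (right_ne_zero_of_mul_eq_one h2)

/-! ### The form `√-1 ∂∂̄ φ` on a complex manifold -/

theorem contDiffOn_comp_symm {φ : X → ℝ} (hφ : ContMDiff 𝓘(ℝ, Cn n) 𝓘(ℝ, ℝ) ∞ φ)
    (he : e ∈ atlas (Cn n) X) : ContDiffOn ℝ ∞ (φ ∘ e.symm) e.target := by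
  have : IsManifold 𝓘(ℝ, Cn n) ∞ X := isManifold_real
  exact (hφ.comp_contMDiffOn (contMDiffOn_symm_of_mem_maximalAtlas
    (IsManifold.subset_maximalAtlas he))).contDiffOn

/-- The definition of `ddbar` uses a chart that varies with the point; naturality under holomorphic
transitions replaces it by any fixed chart, where the form can be differentiated. -/
theorem localRep_ddbar {φ : X → ℝ} (hφ : ContMDiff 𝓘(ℝ, Cn n) 𝓘(ℝ, ℝ) ∞ φ)
    (he : e ∈ atlas (Cn n) X) {y : Cn n} (hy : y ∈ e.target) :
    localRep (ddbar φ) e y = ddbarLocal (φ ∘ e.symm) y := by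
  set c := chartAt (Cn n) (e.symm y) with hc
  have hcm : c ∈ atlas (Cn n) X := chart_mem_atlas _ _
  have hy' : y ∈ (e.symm.trans c).source :=
    mem_transition_source.2 ⟨hy, mem_chart_source _ _⟩
  have h1 : localRep (ddbar φ) e y = (ddbarLocal (φ ∘ c.symm) (c (e.symm y))).compContinuousLinearMap
      ((mfderiv 𝓘(ℝ, Cn n) 𝓘(ℝ, Cn n) c (e.symm y) : Cn n →L[ℝ] Cn n).comp (chartDeriv e y)) := rfl
  rw [h1, chartDeriv_comp_mfderiv he hcm hy']
  have hev : φ ∘ e.symm =ᶠ[𝓝 y] (φ ∘ c.symm) ∘ (c ∘ e.symm) := by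
    filter_upwards [(e.symm.trans c).open_source.mem_nhds hy'] with z hz
    simp [c.left_inv (mem_transition_source.1 hz).2]
  have h2 : ddbarLocal (φ ∘ e.symm) y = ddbarLocal ((φ ∘ c.symm) ∘ (c ∘ e.symm)) y := by
    have : dc (φ ∘ e.symm) =ᶠ[𝓝 y] dc ((φ ∘ c.symm) ∘ (c ∘ e.symm)) := by
      filter_upwards [hev.eventuallyEq_nhds] with z hz
      simp only [dc, hz.fderiv_eq]
    simp only [ddbarLocal, this.extDeriv_eq]
  rw [h2]
  exact (ddbarLocal_comp (e.symm.trans c).open_source c.open_target (contDiffOn_comp_symm hφ hcm)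
    (contDiffOn_transition he hcm) (fun z hz => c.map_source (mem_transition_source.1 hz).2)
    hy').symm

theorem IsClosedRealOneOne.add_ddbar {α : TwoForm n X ℝ} (hα : IsClosedRealOneOne α) {φ : X → ℝ}
    (hφ : ContMDiff 𝓘(ℝ, Cn n) 𝓘(ℝ, ℝ) ∞ φ) : IsClosedRealOneOne (α + ddbar φ) where
  smooth e he := by
    refine ((hα.smooth e he).add (contDiffOn_ddbarLocal e.open_target
      (contDiffOn_comp_symm hφ he))).congr fun y hy => ?_
    rw [localRep_add, localRep_ddbar hφ he hy]
  oneOne e he y hy v w := by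
    rw [localRep_add, localRep_ddbar hφ he hy, ContinuousAlternatingMap.add_apply,
      ContinuousAlternatingMap.add_apply, hα.oneOne e he y hy,
      ddbarLocal_J e.open_target (contDiffOn_comp_symm hφ he) hy]
  closed e he y hy := by
    have hev : localRep (α + ddbar φ) e =ᶠ[𝓝 y] localRep α e + ddbarLocal (φ ∘ e.symm) := by
      filter_upwards [e.open_target.mem_nhds hy] with z hz
      rw [localRep_add, localRep_ddbar hφ he hz]
      rfl
    have hy' := e.open_target.mem_nhds hy
    rw [hev.extDeriv_eq, extDeriv_add, hα.closed e he y hy,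
      extDeriv_ddbarLocal e.open_target (contDiffOn_comp_symm hφ he) hy, add_zero]
    · exact ((hα.smooth e he).contDiffAt hy').differentiableAt (by simp)
    · exact ((contDiffOn_ddbarLocal e.open_target
        (contDiffOn_comp_symm hφ he)).contDiffAt hy').differentiableAt (by simp)

end Charts

/-! ### Integration of top forms -/

section Integration

variable {n : ℕ} {X : Type*} [TopologicalSpace X]

theorem isCompact_chart_image {e : OpenPartialHomeomorph X (Cn n)} {S : Set X}
    (hS : IsCompact S) (hSe : S ⊆ e.source) : IsCompact (e '' S) ∧ e '' S ⊆ e.target :=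
  ⟨hS.image_of_continuousOn (e.continuousOn.mono hSe),
    (image_mono hSe).trans e.image_source_eq_target.subset⟩

theorem symm_notMem_of_notMem_image {e : OpenPartialHomeomorph X (Cn n)} {S : Set X} {y : Cn n}
    (hy : y ∈ e.target \ (e '' S)) : e.symm y ∉ S := fun h =>
  hy.2 ⟨_, h, e.right_inv hy.1⟩

/-- The vanishing hypothesis concerns the product, so S may be the support of either the cutoff ρ or
the form. -/
theorem integrableOn_comp_symm_mul [CompactSpace X] {e : OpenPartialHomeomorph X (Cn n)} {ρ : X → ℝ}
    (hρ : Continuous ρ) {g : Cn n → ℂ} {S : Set X} (hS : IsClosed S) (hSe : S ⊆ e.source)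
    (h0 : ∀ y ∈ e.target, e.symm y ∉ S → (ρ (e.symm y) : ℂ) * g y = 0)
    (hg : ContinuousOn g e.target) :
    IntegrableOn (fun y => (ρ (e.symm y) : ℂ) * g y) e.target := by
  obtain ⟨hK, hKU⟩ := isCompact_chart_image hS.isCompact hSe
  refine integrableOn_of_continuousOn_of_eq_zero e.open_target hK hKU ?_ fun y hy =>
    h0 y hy.1 (symm_notMem_of_notMem_image hy)
  exact (Complex.continuous_ofReal.comp_continuousOn
    (hρ.comp_continuousOn e.continuousOn_symm)).mul hg

variable [ChartedSpace (Cn n) X]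

theorem topCoeff_sub (Ω Ω' : TopForm n X) (e : OpenPartialHomeomorph X (Cn n)) (y : Cn n) :
    topCoeff (Ω - Ω') e y = topCoeff Ω e y - topCoeff Ω' e y := rfl

theorem topCoeff_eq_zero {Ω : TopForm n X} {e : OpenPartialHomeomorph X (Cn n)} {y : Cn n}
    (h : Ω (e.symm y) = 0) : topCoeff Ω e y = 0 := by
  rw [topCoeff, h]; rfl

variable [IsManifold 𝓘(ℂ, Cn n) ω X]

/-- The change of variables formula for top forms. -/
theorem setIntegral_topCoeff_transition {e e' : OpenPartialHomeomorph X (Cn n)}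
    (he : e ∈ atlas (Cn n) X) (he' : e' ∈ atlas (Cn n) X) (ρ : X → ℝ) (Ω : TopForm n X)
    (hρ : ∀ x ∉ e.source, ρ x = 0) (hΩ : ∀ x ∉ e'.source, Ω x = 0) :
    ∫ y in e.target, (ρ (e.symm y) : ℂ) * topCoeff Ω e y
      = ∫ y in e'.target, (ρ (e'.symm y) : ℂ) * topCoeff Ω e' y := by
  set τ := e.symm.trans e' with hτ
  have himage : τ '' τ.source = (e'.symm.trans e).source := by
    rw [τ.image_source_eq_target, hτ]
    ext y
    simp
  -- Both integrals live on the overlap: on the left Ω vanishes off the domain of e', on the right ρ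
  -- vanishes off that of e.
  have h1 : ∫ y in e.target, (ρ (e.symm y) : ℂ) * topCoeff Ω e y
      = ∫ y in τ.source, (ρ (e.symm y) : ℂ) * topCoeff Ω e y := by
    refine setIntegral_eq_of_subset_of_forall_sdiff_eq_zero e.open_target.measurableSet
      (fun y hy => (mem_transition_source.1 hy).1) fun y hy => ?_
    rw [topCoeff_eq_zero (hΩ _ fun h => hy.2 (mem_transition_source.2 ⟨hy.1, h⟩)), mul_zero]
  have h2 : ∫ y in e'.target, (ρ (e'.symm y) : ℂ) * topCoeff Ω e' y
      = ∫ y in (e'.symm.trans e).source, (ρ (e'.symm y) : ℂ) * topCoeff Ω e' y := by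
    refine setIntegral_eq_of_subset_of_forall_sdiff_eq_zero e'.open_target.measurableSet
      (fun y hy => (mem_transition_source.1 hy).1) fun y hy => ?_
    rw [hρ _ fun h => hy.2 (mem_transition_source.2 ⟨hy.1, h⟩), Complex.ofReal_zero, zero_mul]
  rw [h1, h2, ← himage, integral_image_eq_integral_abs_det_fderiv_smul volume
    τ.open_source.measurableSet (f := τ) (f' := fun y => fderiv ℝ (e' ∘ e.symm) y)
    (fun y hy => ((differentiableAt_transition he he' hy).restrictScalars
      ℝ).hasFDerivAt.hasFDerivWithinAt) τ.injOn]
  refine setIntegral_congr_fun τ.open_source.measurableSet fun y hy => ?_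
  have hy2 := (mem_transition_source.1 hy).2
  have hτy : τ y = e' (e.symm y) := rfl
  simp only [hτy]
  rw [det_fderiv_transition he he' hy, abs_of_pos (jacobian_pos he he' hy), e'.left_inv hy2,
    topCoeff_transition Ω he he' hy, Complex.real_smul]
  ring

variable [T2Space X] [CompactSpace X]

variable (n X) in
theorem finite_support_chartPartition : {i : X | (chartPartition n X i : X → ℝ) ≠ 0}.Finite := by
  refine ((chartPartition n X).locallyFinite.finite_nonempty_of_compact).subset fun i hi => ?_
  exact Function.support_nonempty_iff.2 hi

variable (n X) in
/-- The finitely many indices that contribute to an integral. -/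
def chartIndices : Finset X := (finite_support_chartPartition n X).toFinset

theorem chartPartition_eq_zero {i : X} (hi : i ∉ chartIndices n X) (x : X) :
    chartPartition n X i x = 0 := by
  have : (chartPartition n X i : X → ℝ) = 0 := by
    by_contra h
    exact hi ((finite_support_chartPartition n X).mem_toFinset.2 h)
  rw [this]; rfl

theorem sum_chartPartition (x : X) : ∑ i ∈ chartIndices n X, chartPartition n X i x = 1 := by
  rw [← (chartPartition n X).sum_eq_one (mem_univ x)]
  refine (finsum_eq_sum_of_support_subset _ fun i hi => ?_).symm
  by_contra h
  exact hi (chartPartition_eq_zero h x)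

theorem integral_eq_sum (Ω : TopForm n X) :
    integral Ω = ∑ i ∈ chartIndices n X, ∫ y in (chartAt (Cn n) i).target,
      (chartPartition n X i ((chartAt (Cn n) i).symm y) : ℂ) * topCoeff Ω (chartAt (Cn n) i) y := by
  refine finsum_eq_sum_of_support_subset _ fun i hi => ?_
  by_contra h
  refine hi ?_
  simp [chartPartition_eq_zero h]

theorem integrableOn_chartPartition_mul (i : X) {g : Cn n → ℂ}
    (hg : ContinuousOn g (chartAt (Cn n) i).target) :
    IntegrableOn (fun y => (chartPartition n X i ((chartAt (Cn n) i).symm y) : ℂ) * g y)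
      (chartAt (Cn n) i).target :=
  integrableOn_comp_symm_mul (chartPartition n X i).contMDiff.continuous (isClosed_tsupport _)
    (chartPartition_isSubordinate i)
    (fun y _ h => by rw [image_eq_zero_of_notMem_tsupport h, Complex.ofReal_zero, zero_mul]) hg

theorem integral_sub {Ω Ω' : TopForm n X}
    (hΩ : ∀ e ∈ atlas (Cn n) X, ContinuousOn (topCoeff Ω e) e.target)
    (hΩ' : ∀ e ∈ atlas (Cn n) X, ContinuousOn (topCoeff Ω' e) e.target) :
    integral (Ω - Ω') = integral Ω - integral Ω' := by
  simp only [integral_eq_sum, ← Finset.sum_sub_distrib]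
  refine Finset.sum_congr rfl fun i _ => ?_
  rw [← MeasureTheory.integral_sub
    (integrableOn_chartPartition_mul i (hΩ _ (chart_mem_atlas _ i)))
    (integrableOn_chartPartition_mul i (hΩ' _ (chart_mem_atlas _ i)))]
  simp only [topCoeff_sub, mul_sub]

/-- A top form with support in a chart is integrated in that chart. -/
theorem integral_eq_setIntegral {e : OpenPartialHomeomorph X (Cn n)} (he : e ∈ atlas (Cn n) X)
    {Ω : TopForm n X} {S : Set X} (hS : IsClosed S) (hSe : S ⊆ e.source)
    (h0 : ∀ x ∉ S, Ω x = 0) (hΩ : ContinuousOn (topCoeff Ω e) e.target) :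
    integral Ω = ∫ y in e.target, topCoeff Ω e y := by
  rw [integral_eq_sum]
  -- Every summand is moved to the chart e, where the cutoffs add up to 1.
  have h1 : ∀ i ∈ chartIndices n X, ∫ y in (chartAt (Cn n) i).target,
      (chartPartition n X i ((chartAt (Cn n) i).symm y) : ℂ) * topCoeff Ω (chartAt (Cn n) i) y
      = ∫ y in e.target, (chartPartition n X i (e.symm y) : ℂ) * topCoeff Ω e y := fun i _ =>
    setIntegral_topCoeff_transition (chart_mem_atlas _ i) he _ Ω
      (fun x hx => image_eq_zero_of_notMem_tsupport fun h => hx (chartPartition_isSubordinate i h))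
      (fun x hx => h0 x fun h => hx (hSe h))
  rw [Finset.sum_congr rfl h1, ← integral_finsetSum]
  · simp only [← Finset.sum_mul, ← Complex.ofReal_sum, sum_chartPartition, Complex.ofReal_one,
      one_mul]
  · intro i _
    exact integrableOn_comp_symm_mul (chartPartition n X i).contMDiff.continuous hS hSe
      (fun y _ h => by rw [topCoeff_eq_zero (h0 _ h), mul_zero]) hΩ

end Integration

/-! ### Invariance of the integral under `√-1 ∂∂̄`-exact changes -/

theorem continuousOn_tri {U : Set (Cn 3)} {a b c : Cn 3 → Fin 3 × Fin 2 → Fin 3 × Fin 2 → ℂ}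
    (ha : ∀ p q, ContinuousOn (fun y => a y p q) U) (hb : ∀ p q, ContinuousOn (fun y => b y p q) U)
    (hc : ∀ p q, ContinuousOn (fun y => c y p q) U) :
    ContinuousOn (fun y => tri (a y) (b y) (c y)) U :=
  continuousOn_finsetSum _ fun _ _ =>
    continuousOn_const.mul (((ha _ _).mul (hb _ _)).mul (hc _ _))

theorem ddbarLocal_add {n : ℕ} {f g : Cn n → ℝ} {U : Set (Cn n)} (hU : IsOpen U)
    (hf : ContDiffOn ℝ ∞ f U) (hg : ContDiffOn ℝ ∞ g U) {y : Cn n} (hy : y ∈ U) :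
    ddbarLocal (f + g) y = ddbarLocal f y + ddbarLocal g y := by
  have hev : dc (f + g) =ᶠ[𝓝 y] dc f + dc g := by
    filter_upwards [hU.mem_nhds hy] with z hz
    have h1 := (hf.contDiffAt (hU.mem_nhds hz)).differentiableAt (by simp)
    have h2 := (hg.contDiffAt (hU.mem_nhds hz)).differentiableAt (by simp)
    ext v
    have e1 : ∀ k : Cn n → ℝ, dc k z v = -fderiv ℝ k z (J n (v 0)) := fun _ => rfl
    rw [Pi.add_apply, ContinuousAlternatingMap.add_apply, e1, e1, e1, fderiv_add h1 h2,
      _root_.add_apply, neg_add]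
  rw [ddbarLocal, hev.extDeriv_eq, extDeriv_add, smul_add]
  · rfl
  · exact ((contDiffOn_dc hU hf).contDiffAt (hU.mem_nhds hy)).differentiableAt (by simp)
  · exact ((contDiffOn_dc hU hg).contDiffAt (hU.mem_nhds hy)).differentiableAt (by simp)

theorem ddbarLocal_eq_zero {n : ℕ} {f : Cn n → ℝ} {y : Cn n} (hf : f =ᶠ[𝓝 y] fun _ => 0) :
    ddbarLocal f y = 0 := by
  have hev : dc f =ᶠ[𝓝 y] fun _ => 0 := by
    filter_upwards [hf.eventuallyEq_nhds] with z hz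
    ext v
    have e1 : dc f z v = -fderiv ℝ f z (J n (v 0)) := rfl
    rw [e1, hz.fderiv_eq]
    simp
  rw [ddbarLocal, hev.extDeriv_eq, extDeriv]
  simp
  ext v
  simp [ContinuousAlternatingMap.alternatizeUncurryFin_apply]

section Exact

variable {n : ℕ} {X : Type*} [TopologicalSpace X] [ChartedSpace (Cn n) X]

theorem ddbar_eq_zero {ψ : X → ℝ} {x : X} (hx : x ∉ tsupport ψ) :
    ddbar (n := n) ψ x = 0 := by
  have h : ψ ∘ (chartAt (Cn n) x).symm =ᶠ[𝓝 (chartAt (Cn n) x x)] fun _ => 0 := by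
    have h1 : ψ =ᶠ[𝓝 x] 0 := notMem_tsupport_iff_eventuallyEq.1 hx
    have h2 := (chartAt (Cn n) x).continuousAt_symm (mem_chart_target _ x)
    rw [ContinuousAt, (chartAt (Cn n) x).left_inv (mem_chart_source _ x)] at h2
    exact h2.eventually h1
  rw [ddbar, ddbarLocal_eq_zero h]
  rfl

variable [IsManifold 𝓘(ℂ, Cn n) ω X]

theorem ddbar_add {φ ψ : X → ℝ} (hφ : ContMDiff 𝓘(ℝ, Cn n) 𝓘(ℝ, ℝ) ∞ φ)
    (hψ : ContMDiff 𝓘(ℝ, Cn n) 𝓘(ℝ, ℝ) ∞ ψ) :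
    ddbar (n := n) (φ + ψ) = ddbar φ + ddbar ψ := by
  funext x
  have h := ddbarLocal_add (chartAt (Cn n) x).open_target
    (contDiffOn_comp_symm hφ (chart_mem_atlas _ x)) (contDiffOn_comp_symm hψ (chart_mem_atlas _ x))
    (mem_chart_target _ x)
  change (ddbarLocal (φ ∘ (chartAt (Cn n) x).symm + ψ ∘ (chartAt (Cn n) x).symm)
    (chartAt (Cn n) x x)).compContinuousLinearMap _ = _
  rw [h]
  rfl

end Exact

theorem wedgePow_three_comp {V W : Type*} [AddCommGroup V] [Module ℝ V] [TopologicalSpace V]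
    [AddCommGroup W] [Module ℝ W] [TopologicalSpace W] (β : W [⋀^Fin 2]→L[ℝ] ℂ) (L : V →L[ℝ] W)
    (v : Fin 3 × Fin 2 → V) :
    wedgePow 3 β (fun p => L (v p)) = wedgePow 3 (β.compContinuousLinearMap L) v := by
  rw [wedgePow_three_apply, wedgePow_three_apply]
  simp only [twoForm_comp_pair]

/-! ### The integrand of γ: chart expression, positivity and variation with the potential -/

section Gamma

variable {X : Type*} [TopologicalSpace X] [ChartedSpace (Cn 3) X]

theorem modelTop_wedgePow (B : TwoForm 3 X ℂ) (x : X) :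
    modelTop (fun x => wedgePow 3 (B x)) x = wedgePow 3 (modelForm B x) := by
  unfold modelTop modelForm
  congr

theorem topCoeff_wedgePow (B : TwoForm 3 X ℂ) (e : OpenPartialHomeomorph X (Cn 3)) (y : Cn 3) :
    topCoeff (fun x => wedgePow 3 (B x)) e y = wedgePow 3 (localRep B e y) (realBasis 3) := by
  rw [localRep_eq, ← wedgePow_three_comp, topCoeff_eq, modelTop_wedgePow]

theorem continuousOn_topCoeff_wedgePow {χ α : TwoForm 3 X ℝ} (hχ : IsClosedRealOneOne χ)
    (hα : IsClosedRealOneOne α) (t : ℝ) {e : OpenPartialHomeomorph X (Cn 3)}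
    (he : e ∈ atlas (Cn 3) X) :
    ContinuousOn (topCoeff (fun x => wedgePow 3 (complexForm χ α t x)) e) e.target := by
  have hc : ∀ p q, ContinuousOn (fun y => localRep (complexForm χ α t) e y
      ![realBasis 3 p, realBasis 3 q]) e.target := fun p q =>
    (ContinuousAlternatingMap.apply ℝ (Cn 3) ℂ _).continuous.comp_continuousOn
      (contDiffOn_localRep_complexForm hχ hα t he).continuousOn
  refine ((continuousOn_const (c := (1 / 8 : ℂ))).mul (continuousOn_tri hc hc hc)).congr fun y _ => ?_
  rw [topCoeff_wedgePow, wedgePow_three_apply]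
  rfl

variable [IsManifold 𝓘(ℂ, Cn 3) ω X]

/-- The eigenvalues are taken in the preferred chart at the point. Moving there costs a positive
Jacobian, and diagonalisation a positive constant; neither affects the half-plane. -/
theorem re_mul_topCoeff_pos {χ α : TwoForm 3 X ℝ} (hχ : IsKahlerForm χ)
    (hα : IsClosedRealOneOne α) {θ t : ℝ} (hQ : ∀ x, Q χ α x = θ) {ζ : ℂ}
    (hζ : ∀ a b c : ℝ, arccot a + arccot b + arccot c = θ →
      0 < (ζ * (((t * a : ℂ) + Complex.I) * (t * b + Complex.I) * (t * c + Complex.I))).re)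
    {e : OpenPartialHomeomorph X (Cn 3)} (he : e ∈ atlas (Cn 3) X) {y : Cn 3} (hy : y ∈ e.target) :
    0 < (ζ * topCoeff (fun x => wedgePow 3 (complexForm χ α t x)) e y).re := by
  set x := e.symm y
  set k := chartAt (Cn 3) x
  have hk : k ∈ atlas (Cn 3) X := chart_mem_atlas _ x
  have hkx : k x ∈ k.target := mem_chart_target _ x
  have hy' : y ∈ (e.symm.trans k).source := mem_transition_source.2 ⟨hy, mem_chart_source _ x⟩
  obtain ⟨C, a, b, c, hC, hev, hw⟩ := exists_wedgePow_eq (hχ.oneOne k hk (k x) hkx)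
    (hχ.positive k hk (k x) hkx) (hα.oneOne k hk (k x) hkx)
  have hθ : arccot a + arccot b + arccot c = θ := by
    rw [← hQ x, Q, hev]
    simp [add_assoc]
  rw [topCoeff_transition _ he hk hy', topCoeff_wedgePow, localRep_complexForm, hw]
  have h1 : ζ * ((jacobian e k y : ℂ) * (C * (((t * a : ℂ) + Complex.I) * (t * b + Complex.I)
      * (t * c + Complex.I)))) = ((jacobian e k y * C : ℝ) : ℂ) *
      (ζ * (((t * a : ℂ) + Complex.I) * (t * b + Complex.I) * (t * c + Complex.I))) := by
    push_cast; ring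
  rw [h1, Complex.re_ofReal_mul]
  exact mul_pos (mul_pos (jacobian_pos he hk hy') hC) (hζ a b c hθ)

variable [T2Space X] [CompactSpace X]

/-- With B' = B + t √-1 ∂∂̄ψ, B'³ - B³ is t √-1 ∂∂̄ψ wedged with B'² + B B' + B². It is supported in
one chart, and each of the three terms integrates to zero by Stokes. -/
theorem gamma_add_ddbar_of_tsupport_subset {χ α : TwoForm 3 X ℝ} (hχ : IsClosedRealOneOne χ)
    (hα : IsClosedRealOneOne α) (t : ℝ) {ψ : X → ℝ} (hψ : ContMDiff 𝓘(ℝ, Cn 3) 𝓘(ℝ, ℝ) ∞ ψ)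
    {e : OpenPartialHomeomorph X (Cn 3)} (he : e ∈ atlas (Cn 3) X)
    (hsupp : tsupport ψ ⊆ e.source) :
    gamma χ (α + ddbar ψ) t = gamma χ α t := by
  have hα' := hα.add_ddbar hψ
  set B := complexForm χ α t with hB
  set B' := complexForm χ (α + ddbar ψ) t with hB'
  set U := e.target
  set f := ψ ∘ e.symm
  have hf : ContDiffOn ℝ ∞ f U := contDiffOn_comp_symm hψ he
  obtain ⟨hK, hKU⟩ := isCompact_chart_image (isClosed_tsupport ψ).isCompact hsupp
  have hf0 : ∀ y ∈ U \ (e '' tsupport ψ), f y = 0 := fun y hy =>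
    image_eq_zero_of_notMem_tsupport (f := ψ) (symm_notMem_of_notMem_image hy)
  have hBs := contDiffOn_localRep_complexForm hχ hα t he
  have hBs' := contDiffOn_localRep_complexForm hχ hα' t he
  have hBc := fun y (hy : y ∈ U) => extDeriv_localRep_complexForm hχ hα t he hy
  have hBc' := fun y (hy : y ∈ U) => extDeriv_localRep_complexForm hχ hα' t he hy
  let m : TwoForm 3 X ℂ → Cn 3 → Fin 3 × Fin 2 → Fin 3 × Fin 2 → ℂ := fun D y p q =>
    localRep D e y ![realBasis 3 p, realBasis 3 q]
  let N : Cn 3 → Fin 3 × Fin 2 → Fin 3 × Fin 2 → ℂ := fun y p q =>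
    (ddbarLocal f y ![realBasis 3 p, realBasis 3 q] : ℝ)
  have hm : ∀ {D : TwoForm 3 X ℂ}, ContDiffOn ℝ ∞ (localRep D e) U →
      ∀ p q, ContinuousOn (fun y => m D y p q) U := fun hD p q =>
    (ContinuousAlternatingMap.apply ℝ (Cn 3) ℂ _).continuous.comp_continuousOn hD.continuousOn
  have hN : ∀ p q, ContinuousOn (fun y => N y p q) U := fun p q =>
    Complex.continuous_ofReal.comp_continuousOn
      ((ContinuousAlternatingMap.apply ℝ (Cn 3) ℝ _).continuous.comp_continuousOn
        (contDiffOn_ddbarLocal e.open_target hf).continuousOn)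
  have hN0 : ∀ y ∈ U \ (e '' tsupport ψ), N y = 0 := fun y hy => by
    have : f =ᶠ[𝓝 y] fun _ => 0 := by
      filter_upwards [(e.open_target.sdiff hK.isClosed).mem_nhds hy] with z hz using hf0 z hz
    funext p q
    simp [N, ddbarLocal_eq_zero this]
  have hint : ∀ {D D' : TwoForm 3 X ℂ}, ContDiffOn ℝ ∞ (localRep D e) U →
      ContDiffOn ℝ ∞ (localRep D' e) U →
      IntegrableOn (fun y => tri (N y) (m D y) (m D' y)) U := fun hD hD' =>
    integrableOn_of_continuousOn_of_eq_zero e.open_target hK hKU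
      (continuousOn_tri hN (hm hD) (hm hD')) fun y hy => by simp [tri, hN0 y hy]
  have hmain : ∀ y ∈ U, topCoeff ((fun x => wedgePow 3 (B' x)) - fun x => wedgePow 3 (B x)) e y
      = (t / 8 : ℂ) * (tri (N y) (m B' y) (m B' y) + tri (N y) (m B y) (m B' y)
        + tri (N y) (m B y) (m B y)) := by
    intro y hy
    have hBB : m B' y = m B y + (t : ℂ) • N y := by
      funext p q
      simp only [m, N, Pi.add_apply, Pi.smul_apply, smul_eq_mul, hB, hB', localRep_complexForm,
        localRep_add, localRep_ddbar hψ he hy]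
      simp [f]
      ring
    have h1 := tri_add_sub ((t : ℂ) • N y) (m B y)
    rw [← hBB, tri_smul_left, tri_smul_left, tri_smul_left] at h1
    rw [topCoeff_sub, topCoeff_wedgePow, topCoeff_wedgePow, wedgePow_three_apply,
      wedgePow_three_apply]
    linear_combination h1 / 8
  have hzero : ∀ x ∉ tsupport ψ,
      ((fun x => wedgePow 3 (B' x)) - fun x => wedgePow 3 (B x) : TopForm 3 X) x = 0 := by
    intro x hx
    have : B' x = B x := by
      simp only [hB, hB', complexForm, Pi.add_apply, ddbar_eq_zero hx, add_zero]
    rw [Pi.sub_apply, this, sub_self]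
  have hcont : ∀ e ∈ atlas (Cn 3) X,
      ContinuousOn (topCoeff (fun x => wedgePow 3 (B x)) e) e.target :=
    fun e he => continuousOn_topCoeff_wedgePow hχ hα t he
  have hcont' : ∀ e ∈ atlas (Cn 3) X,
      ContinuousOn (topCoeff (fun x => wedgePow 3 (B' x)) e) e.target :=
    fun e he => continuousOn_topCoeff_wedgePow hχ hα' t he
  have hadd : ∫ y in U, (tri (N y) (m B' y) (m B' y) + tri (N y) (m B y) (m B' y)
        + tri (N y) (m B y) (m B y))
      = (∫ y in U, tri (N y) (m B' y) (m B' y)) + (∫ y in U, tri (N y) (m B y) (m B' y))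
        + ∫ y in U, tri (N y) (m B y) (m B y) := by
    have h1 := hint hBs' hBs'
    have h2 := hint hBs hBs'
    rw [← integral_add h1 h2]
    exact integral_add (h1.add h2) (hint hBs hBs)
  rw [← sub_eq_zero, gamma, gamma, ← integral_sub hcont' hcont,
    integral_eq_setIntegral he (isClosed_tsupport ψ) hsupp hzero ((hcont' e he).sub (hcont e he)),
    setIntegral_congr_fun e.open_target.measurableSet hmain, integral_const_mul,
    hadd, setIntegral_tri_ddbarLocal e.open_target hK hKU hf hf0 hBs' hBc' hBs' hBc',
    setIntegral_tri_ddbarLocal e.open_target hK hKU hf hf0 hBs hBc hBs' hBc',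
    setIntegral_tri_ddbarLocal e.open_target hK hKU hf hf0 hBs hBc hBs hBc]
  simp

/-- The integral `∫_X (t α + √-1 χ)³` depends only on the class of `α`. -/
theorem gamma_add_ddbar {χ α : TwoForm 3 X ℝ} (hχ : IsClosedRealOneOne χ)
    (hα : IsClosedRealOneOne α) (t : ℝ) {φ : X → ℝ} (hφ : ContMDiff 𝓘(ℝ, Cn 3) 𝓘(ℝ, ℝ) ∞ φ) :
    gamma χ (α + ddbar φ) t = gamma χ α t := by
  classical
  have hterm : ∀ i : X, ContMDiff 𝓘(ℝ, Cn 3) 𝓘(ℝ, ℝ) ∞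
      (fun x => chartPartition 3 X i x * φ x) := fun i =>
    (chartPartition 3 X i).contMDiff.mul hφ
  have hsum : ∀ s : Finset X, ContMDiff 𝓘(ℝ, Cn 3) 𝓘(ℝ, ℝ) ∞
      (∑ i ∈ s, fun x => chartPartition 3 X i x * φ x) := fun s => by
    induction s using Finset.induction_on with
    | empty => exact contMDiff_const (c := (0 : ℝ))
    | insert i s hi ih => rw [Finset.sum_insert hi]; exact (hterm i).add ih
  -- The pieces ρᵢ φ are added one at a time, each supported in a chart; the partial sums keep the
  -- form closed of type (1,1).
  have key : ∀ s : Finset X,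
      gamma χ (α + ddbar (∑ i ∈ s, fun x => chartPartition 3 X i x * φ x)) t = gamma χ α t := by
    intro s
    induction s using Finset.induction_on with
    | empty =>
      have : ddbar (n := 3) (0 : X → ℝ) = 0 := by
        funext x
        exact ddbar_eq_zero (by simp [tsupport])
      rw [Finset.sum_empty, this, add_zero]
    | insert i s hi ih =>
      rw [Finset.sum_insert hi, add_comm (fun x => chartPartition 3 X i x * φ x),
        ddbar_add (hsum s) (hterm i), ← add_assoc,
        gamma_add_ddbar_of_tsupport_subset hχ (hα.add_ddbar (hsum s)) t (hterm i)
          (chart_mem_atlas _ i), ih]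
      exact (tsupport_mul_subset_left (f := chartPartition 3 X i) (g := φ)).trans
        (chartPartition_isSubordinate i)
  have hφs : φ = ∑ i ∈ chartIndices 3 X, fun x => chartPartition 3 X i x * φ x := by
    funext x
    rw [Finset.sum_apply, ← Finset.sum_mul, sum_chartPartition, one_mul]
  rw [hφs]
  exact key _

/-! ### Non-vanishing -/

theorem gamma_ne_zero [Nonempty X] {χ α : TwoForm 3 X ℝ} (hχ : IsKahlerForm χ)
    (hα : IsClosedRealOneOne α) {θ t : ℝ} (hQ : ∀ x, Q χ α x = θ) (ht : t ∈ Icc (0 : ℝ) 1) :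
    gamma χ α t ≠ 0 := by
  obtain ⟨ζ, hζ⟩ := exists_halfPlane θ t ht
  suffices h : 0 < (ζ * gamma χ α t).re by
    intro h0
    rw [h0, mul_zero] at h
    exact lt_irrefl _ h
  set T : OpenPartialHomeomorph X (Cn 3) → Cn 3 → ℂ :=
    topCoeff (fun x => wedgePow 3 (complexForm χ α t x)) with hT
  have hpos : ∀ i : X, ∀ y ∈ (chartAt (Cn 3) i).target, 0 < (ζ * T (chartAt (Cn 3) i) y).re :=
    fun i y hy => re_mul_topCoeff_pos hχ hα hQ hζ (chart_mem_atlas _ i) hy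
  have hint : ∀ i : X, IntegrableOn (fun y => (chartPartition 3 X i ((chartAt (Cn 3) i).symm y) : ℂ)
      * (ζ * T (chartAt (Cn 3) i) y)) (chartAt (Cn 3) i).target := fun i =>
    integrableOn_chartPartition_mul i (continuousOn_const.mul
      (continuousOn_topCoeff_wedgePow hχ.toIsClosedRealOneOne hα t (chart_mem_atlas _ i)))
  have hre : ∀ i (y : Cn 3), ((chartPartition 3 X i ((chartAt (Cn 3) i).symm y) : ℂ)
      * (ζ * T (chartAt (Cn 3) i) y)).re
      = chartPartition 3 X i ((chartAt (Cn 3) i).symm y) * (ζ * T (chartAt (Cn 3) i) y).re :=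
    fun i y => Complex.re_ofReal_mul _ _
  have hintre : ∀ i : X, IntegrableOn (fun y => chartPartition 3 X i ((chartAt (Cn 3) i).symm y)
      * (ζ * T (chartAt (Cn 3) i) y).re) (chartAt (Cn 3) i).target := fun i => by
    have := (hint i).re
    exact this.congr (Filter.Eventually.of_forall fun y => hre i y)
  have hsum : (ζ * gamma χ α t).re = ∑ i ∈ chartIndices 3 X, ∫ y in (chartAt (Cn 3) i).target,
      chartPartition 3 X i ((chartAt (Cn 3) i).symm y) * (ζ * T (chartAt (Cn 3) i) y).re := by
    rw [gamma, integral_eq_sum, Finset.mul_sum, Complex.re_sum]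
    refine Finset.sum_congr rfl fun i _ => ?_
    rw [← integral_const_mul]
    have h1 := integral_re (hint i)
    simp only [RCLike.re_to_complex, hre] at h1
    rw [h1]
    congr 2
    funext y
    rw [hT]; ring
  rw [hsum]
  refine Finset.sum_pos' (fun i _ => setIntegral_nonneg
    (chartAt (Cn 3) i).open_target.measurableSet fun y hy =>
    mul_nonneg ((chartPartition 3 X).nonneg i _) (hpos i y hy).le) ?_
  -- All summands are nonnegative. At any point some cutoff is positive, hence positive on a
  -- nonempty open set, which makes its integral strictly positive.
  obtain ⟨x⟩ := ‹Nonempty X›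
  obtain ⟨i, hi, hix⟩ : ∃ i ∈ chartIndices 3 X, 0 < chartPartition 3 X i x := by
    by_contra hcon
    push Not at hcon
    have h1 := Finset.sum_nonpos hcon
    rw [sum_chartPartition] at h1
    linarith
  refine ⟨i, hi, ?_⟩
  set k := chartAt (Cn 3) i
  have hxk : x ∈ k.source := by
    by_contra h
    exact hix.ne' (image_eq_zero_of_notMem_tsupport fun h' => h (chartPartition_isSubordinate i h'))
  rw [setIntegral_pos_iff_support_of_nonneg_ae]
  · have hopen : IsOpen (k.target ∩ k.symm ⁻¹' {x | 0 < chartPartition 3 X i x}) :=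
      k.isOpen_inter_preimage_symm
        (isOpen_lt continuous_const (chartPartition 3 X i).contMDiff.continuous)
    refine (hopen.measure_pos volume ⟨k x, k.map_source hxk, ?_⟩).trans_le (measure_mono ?_)
    · simpa [k.left_inv hxk] using hix
    · rintro y ⟨hy, hy'⟩
      exact ⟨(mul_pos hy' (hpos i y hy)).ne', hy⟩
  · refine (ae_restrict_iff' k.open_target.measurableSet).2 (Filter.Eventually.of_forall ?_)
    exact fun y hy => mul_nonneg ((chartPartition 3 X).nonneg i _) (hpos i y hy).le
  · exact hintre i

end Gamma

end DHYM

end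

theorem proposition3p1 {X : Type*} [TopologicalSpace X] [T2Space X] [CompactSpace X] [Nonempty X]
    [ChartedSpace (DHYM.Cn 3) X] [IsManifold 𝓘(ℂ, DHYM.Cn 3) ω X]
    (χ : DHYM.TwoForm 3 X ℝ) (hχ : DHYM.IsKahlerForm χ)
    (α : DHYM.TwoForm 3 X ℝ) (hα : DHYM.IsClosedRealOneOne α)
    (θ : ℝ) (hθ : θ ∈ Ioo 0 (3 * Real.pi))
    (hsol : ∃ φ : X → ℝ, ContMDiff 𝓘(ℝ, DHYM.Cn 3) 𝓘(ℝ, ℝ) ∞ φ ∧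
      ∀ x : X, DHYM.Q χ (α + DHYM.ddbar φ) x = θ)
    (t : ℝ) (ht : t ∈ Icc (0 : ℝ) 1) :
    DHYM.gamma χ α t ≠ 0 := by
  obtain ⟨φ, hφ, hQ⟩ := hsol
  rw [← DHYM.gamma_add_ddbar hχ.toIsClosedRealOneOne hα t hφ]
  exact DHYM.gamma_ne_zero hχ (hα.add_ddbar hφ) hQ ht
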